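/- Let $\mathcal X,\widehat{\mathcal X}$ be finite nonempty alphabets, $d:\mathcal X\times\widehat{\mathcal X}\to[0,\infty)$ a distortion measure, and $d_n(\mathbf x,\mathbf y)=\frac1n\sum_{k=1}^n d(x_k,y_k)$ for blocks of length $n$. For a probability distribution $p$ on $\mathcal X$ let $D_{\min}(p)=\sum_x p(x)\min_{y} d(x,y)$, and for $D\ge D_{\min}(p)$ let $R(p,D)=\min_W I(p,W)$ be its rate-distortion function, the minimum of the mutual information (in nats) over all transition matrices $W$ from $\mathcal X$ to $\widehat{\mathcal X}$ with $\sum_{x,y}p(x)W(y|x)d(x,y)\le D$. An arbitrarily varying source has $m\ge1$ subsources: the vectors $(x_{1,k},\dots,x_{m,k})\in\mathcal X^m$, $k=1,2,\dots$, are IID over time with an arbitrary joint law $P$ (the subsources may be dependent of each other). At each time $k$ a switcher chooses a position $s_k\in\{1,\dots,m\}$, and the source outputs $x_k=x_{s_k,k}$. With 1-step lookahead, $s_k$ is a (possibly random) function of the subsource outputs at times $1,\dots,k$ (or, in a variant, of those at time $k$ only); with full lookahead, $(s_1,\dots,s_n)$ is a (possibly random) function of all subsource outputs in the block of length $n$.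 Let $M(n,D)$ be the least size of a nonempty codebook $\mathcal B\subseteq\widehat{\mathcal X}^n$ with $\mathbb E[\min_{\mathbf y\in\mathcal B}d_n(\mathbf x^n,\mathbf y)]\le D$ for every allowable switcher strategy, $M(n,D)=\infty$ if there is none, and let $R(D)=\limsup_{n\to\infty}\frac1n\ln M(n,D)$. Put $$\mathcal C=\Big\{p:\ \sum_{i\in V}p(i)\ge P(x_l\in V,\ 1\le l\le m)\ \text{ for every } V\subseteq\mathcal X\Big\},\qquad D_{\min}(\mathcal C)=\sup_{p\in\mathcal C}D_{\min}(p).$$ Then, for 1-step lookahead (in either variant) and for full lookahead: 1. if $D>D_{\min}(\mathcal C)$, then $R(D)=\max_{p\in\mathcal C}R(p,D)$; the maximum is attained, and $\liminf_{n\to\infty}\frac1n\ln M(n,D)$ has the same value; 2. if $D<D_{\min}(\mathcal C)$, then $R(D)=\infty$. Moreover, $\mathcal C$ is the set of distributions that the switcher can simulate by memoryless randomized rules, that is, the set of all $p=\sum_{V}\beta(V)f(\cdot|V)$, where $V$ runs over the nonempty subsets of $\mathcal X$ with at most $m$ elements, $\beta(V)=P(\{x_1,\dots,x_m\}=V)$,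 and each $f(\cdot|V)$ is an arbitrary probability mass function on $V$. -/

import Mathlib

open scoped BigOperators

noncomputable section

namespace AVS

section RateDistortion

variable {X Y : Type*} [Fintype X] [Fintype Y]

/-- Minimum average distortion `D_min(p) = ∑ₓ p(x) min_y d(x, y)`. -/
def dmin [Nonempty Y] (d : X → Y → ℝ) (p : X → ℝ) : ℝ :=
  ∑ x, p x * Finset.univ.inf' Finset.univ_nonempty (fun y => d x y)

/-- `D_min(Q) = sup_{p ∈ Q} D_min(p)` for a set `Q` of distributions. -/
def dminSet [Nonempty Y] (d : X → Y → ℝ) (Q : Set (X → ℝ)) : ℝ :=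
  sSup (dmin d '' Q)

/-- Mutual information `I(p, W)` in nats, for a source law `p` and a transition matrix
`W x y = W(y|x)`. A term with `p(x) W(y|x) = 0` is zero, as usual. -/
def mutualInfo (p : X → ℝ) (W : X → Y → ℝ) : ℝ :=
  ∑ x, ∑ y, p x * W x y * Real.log (W x y / ∑ x', p x' * W x' y)

/-- Transition matrices from `X` to `Y` whose average distortion under `p` is at most `D`. -/
def admissible (d : X → Y → ℝ) (p : X → ℝ) (D : ℝ) : Set (X → Y → ℝ) :=
  {W | (∀ x, W x ∈ stdSimplex ℝ Y) ∧ ∑ x, ∑ y, p x * W x y * d x y ≤ D}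

/-- Rate-distortion function `R(p, D)` of the distribution `p`. -/
def rateDistortion (d : X → Y → ℝ) (p : X → ℝ) (D : ℝ) : ℝ :=
  sInf (mutualInfo p '' admissible d p D)

/-- Per-letter distortion of two blocks of length `n`. -/
def blockDist (d : X → Y → ℝ) {n : ℕ} (x : Fin n → X) (y : Fin n → Y) : ℝ :=
  (1 / (n : ℝ)) * ∑ k, d (x k) (y k)

/-- Distortion of a block with respect to a (nonempty) codebook. -/
def codeDist (d : X → Y → ℝ) {n : ℕ} (B : Finset (Fin n → Y)) (hB : B.Nonempty)
    (x : Fin n → X) : ℝ :=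
  B.inf' hB (fun y => blockDist d x y)

end RateDistortion

section Source

variable {X : Type*} [Fintype X] [DecidableEq X] {m : ℕ}

/-- `P(x_l ∈ V for all l)`, for a joint law `P` of the `m` subsource outputs at one time. -/
def probAllIn (P : (Fin m → X) → ℝ) (V : Finset X) : ℝ :=
  ∑ a ∈ Finset.univ.filter (fun a : Fin m → X => ∀ l, a l ∈ V), P a

/-- The set `C`: distributions `p` with `p(V) ≥ P(x_l ∈ V for all l)` for every `V ⊆ X`. -/
def setC (P : (Fin m → X) → ℝ) : Set (X → ℝ) :=
  {p | p ∈ stdSimplex ℝ X ∧ ∀ V : Finset X, ∑ i ∈ V, p i ≥ probAllIn P V}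

/-- `β(V) = P({x_1, …, x_m} = V)`. -/
def beta (P : (Fin m → X) → ℝ) (V : Finset X) : ℝ :=
  ∑ a ∈ Finset.univ.filter (fun a : Fin m → X => Finset.univ.image a = V), P a

/-- The set of distributions `∑_V β(V) f(·|V)`, where each `f(·|V)`, for `V` nonempty with at most
`m` elements, is a probability mass function on `V`. -/
def setSim (P : (Fin m → X) → ℝ) : Set (X → ℝ) :=
  {p | p ∈ stdSimplex ℝ X ∧ ∃ f : Finset X → X → ℝ,
    (∀ V : Finset X, V.Nonempty → V.card ≤ m →
      f V ∈ stdSimplex ℝ X ∧ ∀ x, x ∉ V → f V x = 0) ∧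
    ∀ x, p x = ∑ V ∈ Finset.univ.filter (fun V : Finset X => V.Nonempty ∧ V.card ≤ m),
      beta P V * f V x}

end Source

section Switcher

/-- A table of numbers `P(sⁿ | x₁ⁿ, …, x_mⁿ)`. The subsource outputs over a block are
`ω : Fin n → Fin m → X`, where `ω k l` is the output of subsource `l` at time `k`, and
`s : Fin n → Fin m` are the switch positions. -/
abbrev Rule (X : Type*) (m n : ℕ) : Type _ :=
  (Fin n → Fin m → X) → (Fin n → Fin m) → ℝ

/-- The information that is available to the switcher. -/
inductive Lookahead
  /-- 1-step lookahead without memory: `s_k` depends on the subsource outputs at time `k`. -/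
  | current
  /-- 1-step lookahead: `s_k` depends on the subsource outputs up to and including time `k`. -/
  | oneStep
  /-- Full lookahead: `sⁿ` depends on the subsource outputs of the whole block. -/
  | full

/-- Full lookahead: an arbitrary conditional distribution of `sⁿ` given all outputs. -/
def fullRules (X : Type*) (m n : ℕ) : Set (Rule X m n) :=
  {Q | ∀ ω, Q ω ∈ stdSimplex ℝ (Fin n → Fin m)}

/-- 1-step lookahead: a conditional distribution of `sⁿ` given all outputs under which, for every
time `k`, the law of `(s_1, …, s_k)` is a function of the outputs at times `1, …, k` only. -/
def oneStepRules (X : Type*) (m n : ℕ) : Set (Rule X m n) :=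
  {Q | (∀ ω, Q ω ∈ stdSimplex ℝ (Fin n → Fin m)) ∧
    ∀ (k : Fin n) (ω ω' : Fin n → Fin m → X), (∀ j ≤ k, ω j = ω' j) →
      ∀ t : Fin n → Fin m,
        ∑ s ∈ Finset.univ.filter (fun s : Fin n → Fin m => ∀ j ≤ k, s j = t j), Q ω s =
        ∑ s ∈ Finset.univ.filter (fun s : Fin n → Fin m => ∀ j ≤ k, s j = t j), Q ω' s}

/-- 1-step lookahead without memory: at each time `k` the position `s_k` is drawn, independently
of everything else, from a distribution that depends on the outputs at time `k` only. -/
def currentRules (X : Type*) (m n : ℕ) : Set (Rule X m n) :=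
  {Q | ∃ q : Fin n → (Fin m → X) → Fin m → ℝ,
    (∀ k a, q k a ∈ stdSimplex ℝ (Fin m)) ∧ ∀ ω s, Q ω s = ∏ k, q k (ω k) (s k)}

/-- The allowable switcher strategies for blocks of length `n`. -/
def rules (X : Type*) (m : ℕ) : Lookahead → (n : ℕ) → Set (Rule X m n)
  | .current, n => currentRules X m n
  | .oneStep, n => oneStepRules X m n
  | .full, n => fullRules X m n

variable {X Y : Type*} [Fintype X] [DecidableEq X] {m n : ℕ}

/-- Joint law `P(sⁿ, xⁿ)` of the switch positions and the source output `x_k = x_{s_k, k}`, when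
the subsource outputs are IID over time with law `P` and the switcher uses `Q`. -/
def jointLaw (P : (Fin m → X) → ℝ) (Q : Rule X m n) (s : Fin n → Fin m) (x : Fin n → X) : ℝ :=
  ∑ ω : Fin n → Fin m → X,
    (∏ k, P (ω k)) * (Q ω s * ∏ k, if x k = ω k (s k) then 1 else 0)

/-- Expected distortion `E[d_n(xⁿ; B)]` of a codebook when the switcher uses `Q`. -/
def expDist (d : X → Y → ℝ) (P : (Fin m → X) → ℝ) (Q : Rule X m n)
    (B : Finset (Fin n → Y)) (hB : B.Nonempty) : ℝ :=
  ∑ x : Fin n → X, (∑ s : Fin n → Fin m, jointLaw P Q s x) * codeDist d B hB x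

/-- `M(n, D)`: the least size of a codebook of block length `n` with expected distortion at most
`D` for all allowable switcher strategies, and `∞` if there is none. -/
def minCode (d : X → Y → ℝ) (P : (Fin m → X) → ℝ) (a : Lookahead) (n : ℕ) (D : ℝ) : ℕ∞ :=
  ⨅ (B : Finset (Fin n → Y)) (hB : B.Nonempty)
    (_ : ∀ Q ∈ rules X m a n, expDist d P Q B hB ≤ D), (B.card : ℕ∞)

/-- `(1 / n) ln M(n, D)`, in nats, with `ln ∞ = ∞`. -/
def blockRate (d : X → Y → ℝ) (P : (Fin m → X) → ℝ) (a : Lookahead) (D : ℝ) (n : ℕ) : EReal :=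
  ENNReal.log (ENat.toENNReal (minCode d P a n D)) / (n : EReal)

/-- Rate-distortion function `R(D) = limsup_n (1 / n) ln M(n, D)` of the source. -/
def rate (d : X → Y → ℝ) (P : (Fin m → X) → ℝ) (a : Lookahead) (D : ℝ) : EReal :=
  Filter.limsup (blockRate d P a D) Filter.atTop

end Switcher

end AVS

end

namespace AVS

/-! ### Sums against product laws and a Chebyshev bound -/

section ProductSums

variable {A : Type*} [Fintype A] {n : ℕ}

/-! The three classes of rules lie between the memoryless ones and those with full lookahead, so the
converse is proved against the weakest switcher and the direct part against the strongest; the two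
bounds meet at the maximum of R(p, D) over C.

Converse. By `setC_eq_setSim` and `exists_current_rule`, a memoryless rule can make the output IID
with any law p in C. A codebook that works for every rule therefore works for each such IID source:
its distortion is at least D_min(p) (`dmin_le_sum_codeDist`), and its logarithmic size is at least n
R(p, D) (`mul_rateDistortion_le_log_card`). The inclusion of C in the simulable set is by
separation: for a linear functional, the rule that always picks the best available letter
stochastically dominates every p in C.

Direct part. Even with full lookahead the output lies in V whenever all subsources do. By Chebyshev
and a union bound over the finitely many V, the type of the output is close to C outside an event of
probability O(1/n) (`expDist_le`). A test channel that is nearly optimal for p serves all types near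
p, and greedy covering turns it into a codebook (`exists_codebook`). Compactness of the simplex
leaves finitely many codebooks to unite (`exists_codebook_near_setC`), which does not change the
exponent. The maximum is attained because R(·, D) is upper semicontinuous on the compact set C. -/

theorem sum_prod_eq_prod_sum (F : Fin n → A → ℝ) :
    ∑ a : Fin n → A, ∏ k, F k (a k) = ∏ k, ∑ b, F k b := by
  classical
  rw [Finset.prod_univ_sum, Fintype.piFinset_univ]

theorem sum_prod_simplex {w : Fin n → A → ℝ} (hw : ∀ k, w k ∈ stdSimplex ℝ A) :
    ∑ a : Fin n → A, ∏ k, w k (a k) = 1 := by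
  rw [sum_prod_eq_prod_sum]
  exact Finset.prod_eq_one fun k _ => (hw k).2

theorem sum_prod_mul_apply {w : Fin n → A → ℝ} (hw : ∀ k, w k ∈ stdSimplex ℝ A)
    (i : Fin n) (h : A → ℝ) :
    ∑ a : Fin n → A, (∏ k, w k (a k)) * h (a i) = ∑ b, w i b * h b := by
  have e : ∀ a : Fin n → A, (∏ k, w k (a k)) * h (a i)
      = ∏ k, (w k (a k) * if k = i then h (a k) else 1) := by
    intro a
    rw [Finset.prod_mul_distrib]
    simp
  simp_rw [e]
  rw [sum_prod_eq_prod_sum (fun k b => w k b * if k = i then h b else 1),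
    Finset.prod_eq_single i]
  · simp
  · intro k _ hk
    simp [hk, (hw k).2]
  · simp

theorem sum_prod_mul_apply_mul_apply {w : Fin n → A → ℝ} {i j : Fin n} (hij : i ≠ j)
    (g h : A → ℝ) (hg : ∑ b, w i b * g b = 0) :
    ∑ a : Fin n → A, (∏ k, w k (a k)) * (g (a i) * h (a j)) = 0 := by
  have e : ∀ a : Fin n → A, (∏ k, w k (a k)) * (g (a i) * h (a j))
      = ∏ k, (w k (a k) * ((if k = i then g (a k) else 1) * if k = j then h (a k) else 1)) := by
    intro a
    rw [Finset.prod_mul_distrib, Finset.prod_mul_distrib]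
    simp
  simp_rw [e]
  rw [sum_prod_eq_prod_sum
    (fun k b => w k b * ((if k = i then g b else 1) * if k = j then h b else 1))]
  refine Finset.prod_eq_zero (Finset.mem_univ i) ?_
  simpa [hij] using hg

/-- By independence and centring the off-diagonal terms of the expanded square vanish, and each of
the n diagonal terms is at most M². -/
theorem second_moment_le {w : Fin n → A → ℝ} (hw : ∀ k, w k ∈ stdSimplex ℝ A)
    (g : Fin n → A → ℝ) (hg : ∀ k, ∑ b, w k b * g k b = 0) (M : ℝ) (hM : ∀ k b, |g k b| ≤ M) :
    ∑ a : Fin n → A, (∏ k, w k (a k)) * (∑ k, g k (a k)) ^ 2 ≤ n * M ^ 2 := by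
  have e : ∀ a : Fin n → A, (∏ k, w k (a k)) * (∑ k, g k (a k)) ^ 2
      = ∑ i, ∑ j, (∏ k, w k (a k)) * (g i (a i) * g j (a j)) := by
    intro a
    rw [sq, Finset.sum_mul_sum, Finset.mul_sum]
    simp_rw [Finset.mul_sum]
  simp_rw [e]
  rw [Finset.sum_comm]
  have e2 : ∀ i : Fin n, ∑ a : Fin n → A, ∑ j, (∏ k, w k (a k)) * (g i (a i) * g j (a j))
      ≤ M ^ 2 := by
    intro i
    rw [Finset.sum_comm, Finset.sum_eq_single i]
    · rw [sum_prod_mul_apply hw i (fun b => g i b * g i b)]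
      calc ∑ b, w i b * (g i b * g i b) ≤ ∑ b, w i b * M ^ 2 := by
            refine Finset.sum_le_sum fun b _ => mul_le_mul_of_nonneg_left ?_ ((hw i).1 b)
            rw [← sq]
            exact sq_le_sq' (abs_le.1 (hM i b)).1 (abs_le.1 (hM i b)).2
        _ = M ^ 2 := by rw [← Finset.sum_mul, (hw i).2, one_mul]
    · intro j _ hj
      exact sum_prod_mul_apply_mul_apply hj.symm _ _ (hg i)
    · simp
  calc _ ≤ ∑ _i : Fin n, M ^ 2 := Finset.sum_le_sum fun i _ => e2 i
    _ = n * M ^ 2 := by simp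

/-- Chebyshev's inequality for sums of independent bounded variables. -/
theorem tail_le {w : Fin n → A → ℝ} (hw : ∀ k, w k ∈ stdSimplex ℝ A)
    (h : Fin n → A → ℝ) (M : ℝ) (hM : ∀ k b, |h k b| ≤ M) (hn : 0 < n) {η : ℝ} (hη : 0 < η) :
    ∑ a : Fin n → A with n * η < ∑ k, h k (a k) - ∑ k, ∑ b, w k b * h k b, ∏ k, w k (a k)
      ≤ 4 * M ^ 2 / η ^ 2 / n := by
  have hn' : (0 : ℝ) < n := by exact_mod_cast hn
  set μ : Fin n → ℝ := fun k => ∑ b, w k b * h k b with hμ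
  have hμM : ∀ k, |μ k| ≤ M := by
    intro k
    calc |μ k| ≤ ∑ b, |w k b * h k b| := Finset.abs_sum_le_sum_abs _ _
      _ ≤ ∑ b, w k b * M := by
          refine Finset.sum_le_sum fun b _ => ?_
          rw [abs_mul, abs_of_nonneg ((hw k).1 b)]
          exact mul_le_mul_of_nonneg_left (hM k b) ((hw k).1 b)
      _ = M := by rw [← Finset.sum_mul, (hw k).2, one_mul]
  -- Centring at most doubles the bound M; this is the source of the factor 4.
  have key := second_moment_le hw (fun k b => h k b - μ k)
    (fun k => by
      simp_rw [mul_sub]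
      rw [Finset.sum_sub_distrib, ← Finset.sum_mul, (hw k).2, one_mul, sub_self]) (2 * M)
    (fun k b => by
      have := abs_sub (h k b) (μ k)
      linarith [hM k b, hμM k])
  have hpos : ∀ a : Fin n → A, 0 ≤ ∏ k, w k (a k) :=
    fun a => Finset.prod_nonneg fun k _ => (hw k).1 _
  rw [div_div, le_div_iff₀ (by positivity), Finset.sum_mul]
  have : ∑ a : Fin n → A with n * η < ∑ k, h k (a k) - ∑ k, μ k,
      (∏ k, w k (a k)) * (n * η) ^ 2 ≤ n * (2 * M) ^ 2 := by
    refine le_trans (le_trans (Finset.sum_le_sum fun a ha => ?_)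
      (Finset.sum_le_sum_of_subset_of_nonneg (Finset.filter_subset _ _)
        fun a _ _ => mul_nonneg (hpos a) (sq_nonneg _))) key
    refine mul_le_mul_of_nonneg_left ?_ (hpos a)
    have h1 := (Finset.mem_filter.1 ha).2
    rw [Finset.sum_sub_distrib]
    exact pow_le_pow_left₀ (by positivity) h1.le 2
  rw [← Finset.sum_mul] at this ⊢
  refine le_of_mul_le_mul_left ?_ hn'
  nlinarith [this]

end ProductSums

/-! ### Greedy covering and codebooks for blocks of suitable type -/

theorem exists_abs_le {A B : Type*} [Finite A] [Finite B] (h : A → B → ℝ) :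
    ∃ M, ∀ a b, |h a b| ≤ M := by
  obtain ⟨M, hM⟩ := (Set.finite_range fun z : A × B => |h z.1 z.2|).bddAbove
  exact ⟨M, fun a b => hM ⟨(a, b), rfl⟩⟩

/-- Greedy covering: if each `x ∈ S` is covered by a `q`-random `y` with probability at least `θ`,
then `N` suitable points leave at most `|S| (1 - θ)^N` points of `S` uncovered. -/
theorem exists_cover {A B : Type*} [Fintype B] (S : Finset A) (r : A → B → Prop)
    [∀ a b, Decidable (r a b)] (q : B → ℝ) (hq : q ∈ stdSimplex ℝ B) (θ : ℝ) (hθ : θ ≤ 1)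
    (h : ∀ x ∈ S, θ ≤ ∑ y with r x y, q y) (N : ℕ) :
    ∃ (T : Finset B) (U : Finset A), T.card ≤ N ∧ (∀ x ∈ S, (∃ y ∈ T, r x y) ∨ x ∈ U) ∧ U ⊆ S ∧
      (U.card : ℝ) ≤ S.card * (1 - θ) ^ N := by
  classical
  induction N with
  | zero => exact ⟨∅, S, by simp, fun x hx => Or.inr hx, subset_rfl, by simp⟩
  | succ N ih =>
    obtain ⟨T, U, hT, hTU, hUS, hS⟩ := ih
    -- On average a `q`-random point covers a fraction θ of what is still uncovered, so some point
    -- does at least as well.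
    have hav : ∑ y, q y * (U.card * θ) ≤ ∑ y, q y * ((U.filter fun x => r x y).card : ℝ) := by
      rw [← Finset.sum_mul, hq.2, one_mul]
      calc (U.card : ℝ) * θ = ∑ x ∈ U, θ := by simp
        _ ≤ ∑ x ∈ U, ∑ y with r x y, q y :=
            Finset.sum_le_sum fun x hx => h x (hUS hx)
        _ = ∑ y, q y * ((U.filter fun x => r x y).card : ℝ) := by
            simp_rw [Finset.sum_filter]
            rw [Finset.sum_comm]
            refine Finset.sum_congr rfl fun y _ => ?_
            rw [← Finset.sum_filter, Finset.sum_const, nsmul_eq_mul, mul_comm]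
    obtain ⟨y, hy⟩ : ∃ y, (U.card : ℝ) * θ ≤ ((U.filter fun x => r x y).card : ℝ) := by
      by_contra! hcon
      obtain ⟨y₀, -, hy₀⟩ : ∃ y ∈ Finset.univ, 0 < q y :=
        Finset.exists_lt_of_sum_lt (by simp [hq.2])
      refine absurd hav (not_le.2 (Finset.sum_lt_sum (fun y _ => ?_) ⟨y₀, Finset.mem_univ _, ?_⟩))
      · exact mul_le_mul_of_nonneg_left (hcon y).le (hq.1 y)
      · exact mul_lt_mul_of_pos_left (hcon y₀) hy₀
    refine ⟨insert y T, U.filter fun x => ¬ r x y, (Finset.card_insert_le _ _).trans (by omega),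
      fun x hx => ?_, (Finset.filter_subset _ _).trans hUS, ?_⟩
    · by_cases hxy : r x y
      · exact Or.inl ⟨y, Finset.mem_insert_self _ _, hxy⟩
      · rcases hTU x hx with ⟨z, hz, hxz⟩ | hxU
        · exact Or.inl ⟨z, Finset.mem_insert_of_mem hz, hxz⟩
        · exact Or.inr (Finset.mem_filter.2 ⟨hxU, hxy⟩)
    have hc := Finset.card_filter_add_card_filter_not (s := U) (fun x => r x y)
    have hc' : ((U.filter fun x => r x y).card : ℝ) + (U.filter fun x => ¬ r x y).card
        = U.card := by exact_mod_cast hc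
    calc ((U.filter fun x => ¬ r x y).card : ℝ) ≤ U.card * (1 - θ) := by linarith
      _ ≤ (S.card * (1 - θ) ^ N) * (1 - θ) := mul_le_mul_of_nonneg_right hS (by linarith)
      _ = _ := by ring

section Empirical

variable {X Y : Type*} [Fintype X] [DecidableEq X] [Fintype Y] {n : ℕ}

/-- The type (empirical distribution) of a block. -/
noncomputable def empirical (x : Fin n → X) (i : X) : ℝ :=
  (∑ k, if x k = i then (1 : ℝ) else 0) / n

theorem sum_empirical_mul (x : Fin n → X) (h : X → ℝ) :
    ∑ i, empirical x i * h i = (∑ k, h (x k)) / n := by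
  simp_rw [empirical, div_mul_eq_mul_div]
  rw [← Finset.sum_div]
  congr 1
  simp_rw [Finset.sum_mul]
  rw [Finset.sum_comm]
  simp

theorem empirical_mem (x : Fin n → X) (hn : 0 < n) : empirical x ∈ stdSimplex ℝ X := by
  constructor
  · intro i
    exact div_nonneg (Finset.sum_nonneg fun k _ => by split_ifs <;> norm_num) (Nat.cast_nonneg _)
  · have := sum_empirical_mul x fun _ => 1
    simp only [mul_one] at this
    rw [this]
    have : (n : ℝ) ≠ 0 := by positivity
    simp [this]

theorem sum_empirical (x : Fin n → X) (V : Finset X) :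
    ∑ i ∈ V, empirical x i = (∑ k, if x k ∈ V then (1 : ℝ) else 0) / n := by
  have := sum_empirical_mul x fun i => if i ∈ V then 1 else 0
  simpa using this

/-- Random codewords drawn from `q` are close to `x` with exponentially bounded probability. -/
theorem ball_prob_ge (d : X → Y → ℝ) (W : X → Y → ℝ) (hW : ∀ x, W x ∈ stdSimplex ℝ Y)
    (q : Y → ℝ) (hq : ∀ y, 0 < q y) (D c η : ℝ) (hη : 0 < η) :
    ∃ n₀ : ℕ, ∀ n, n₀ ≤ n → 0 < n → ∀ x : Fin n → X,
      ∑ i, empirical x i * ∑ y, W i y * d i y ≤ D →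
      ∑ i, empirical x i * ∑ y, W i y * Real.log (W i y / q y) ≤ c →
      Real.exp (-(n * (c + η))) / 2 ≤
        ∑ y : Fin n → Y with blockDist d x y ≤ D + η, ∏ k, q (y k) := by
  obtain ⟨M₁, hM₁⟩ := exists_abs_le d
  obtain ⟨M₂, hM₂⟩ := exists_abs_le fun x y => Real.log (W x y / q y)
  -- Chosen so that the two Chebyshev tails, for distortion and for log-likelihood, add up to at
  -- most 1/2.
  obtain ⟨n₀, hn₀⟩ := exists_nat_ge (4 * (4 * M₁ ^ 2 / η ^ 2 + 4 * M₂ ^ 2 / η ^ 2))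
  refine ⟨n₀, fun n hn hpos x h1 h2 => ?_⟩
  have hn' : (0 : ℝ) < n := by exact_mod_cast hpos
  have t1 := tail_le (w := fun k => W (x k)) (fun k => hW (x k)) (fun k => d (x k)) M₁
    (fun k => hM₁ (x k)) hpos hη
  have t2 := tail_le (w := fun k => W (x k)) (fun k => hW (x k))
    (fun k y => Real.log (W (x k) y / q y)) M₂ (fun k => hM₂ (x k)) hpos hη
  rw [sum_empirical_mul x (fun i => ∑ y, W i y * d i y), div_le_iff₀ hn'] at h1
  rw [sum_empirical_mul x (fun i => ∑ y, W i y * Real.log (W i y / q y)), div_le_iff₀ hn'] at h2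
  have hsmall : 4 * M₁ ^ 2 / η ^ 2 / n + 4 * M₂ ^ 2 / η ^ 2 / n ≤ 1 / 2 := by
    rw [← add_div, div_le_iff₀ hn']
    have : (n₀ : ℝ) ≤ n := by exact_mod_cast hn
    linarith
  have hw : ∀ y : Fin n → Y, 0 ≤ ∏ k, W (x k) (y k) :=
    fun y => Finset.prod_nonneg fun k _ => (hW _).1 _
  have hqp : ∀ y : Fin n → Y, 0 < ∏ k, q (y k) := fun y => Finset.prod_pos fun k _ => hq _
  -- Change of measure from `q` to the channel output given `x`: if neither sum deviates, then `y`
  -- is in the ball and the likelihood ratio is at most exp(n(c + η)).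
  have hmain : ∀ y : Fin n → Y, Real.exp (-(n * (c + η))) * ∏ k, W (x k) (y k) ≤
      (if blockDist d x y ≤ D + η then ∏ k, q (y k) else 0) +
      Real.exp (-(n * (c + η))) *
        ((if n * η < ∑ k, d (x k) (y k) - ∑ k, ∑ b, W (x k) b * d (x k) b then
          ∏ k, W (x k) (y k) else 0) +
        (if n * η < ∑ k, Real.log (W (x k) (y k) / q (y k)) -
            ∑ k, ∑ b, W (x k) b * Real.log (W (x k) b / q b) then
          ∏ k, W (x k) (y k) else 0)) := by
    intro y
    have he := Real.exp_pos (-(n * (c + η)))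
    have hiq : 0 ≤ (if blockDist d x y ≤ D + η then ∏ k, q (y k) else 0) := by
      split_ifs
      · exact (hqp y).le
      · exact le_rfl
    by_cases c1 : n * η < ∑ k, d (x k) (y k) - ∑ k, ∑ b, W (x k) b * d (x k) b
    · rw [if_pos c1]
      have : 0 ≤ (if n * η < ∑ k, Real.log (W (x k) (y k) / q (y k)) -
            ∑ k, ∑ b, W (x k) b * Real.log (W (x k) b / q b) then
          ∏ k, W (x k) (y k) else 0) := by
        split_ifs
        · exact hw y
        · exact le_rfl
      nlinarith [mul_nonneg he.le this]
    by_cases c2 : n * η < ∑ k, Real.log (W (x k) (y k) / q (y k)) -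
            ∑ k, ∑ b, W (x k) b * Real.log (W (x k) b / q b)
    · rw [if_neg c1, if_pos c2]
      linarith
    rw [if_neg c1, if_neg c2, if_pos]
    · rw [add_zero, mul_zero, add_zero]
      -- If some W(y_k|x_k) is zero, the convention `Real.log 0 = 0` spoils the likelihood ratio,
      -- but then the left side vanishes.
      rcases (hw y).eq_or_lt with h0 | h0
      · rw [← h0, mul_zero]
        exact (hqp y).le
      · have hWk : ∀ k, 0 < W (x k) (y k) := fun k =>
          lt_of_le_of_ne ((hW _).1 _)
            (Ne.symm (Finset.prod_ne_zero_iff.1 h0.ne' k (Finset.mem_univ k)))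
        have hlog : ∏ k, W (x k) (y k) =
            Real.exp (∑ k, Real.log (W (x k) (y k) / q (y k))) * ∏ k, q (y k) := by
          rw [Real.exp_sum, ← Finset.prod_mul_distrib]
          refine Finset.prod_congr rfl fun k _ => ?_
          rw [Real.exp_log (div_pos (hWk k) (hq _)), div_mul_cancel₀ _ (hq _).ne']
        rw [hlog, ← mul_assoc, ← Real.exp_add]
        refine mul_le_of_le_one_left (hqp y).le (Real.exp_le_one_iff.2 ?_)
        linarith
    · rw [blockDist, one_div, inv_mul_le_iff₀ hn']
      linarith
  have hsum := Finset.sum_le_sum fun y (_ : y ∈ (Finset.univ : Finset (Fin n → Y))) => hmain y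
  rw [Finset.sum_add_distrib, ← Finset.mul_sum, ← Finset.mul_sum, Finset.sum_add_distrib,
    sum_prod_simplex fun k => hW (x k), ← Finset.sum_filter, ← Finset.sum_filter,
    ← Finset.sum_filter] at hsum
  have he := Real.exp_pos (-(n * (c + η)))
  have := mul_le_mul_of_nonneg_left ((add_le_add t1 t2).trans hsmall) he.le
  linarith

/-- All blocks whose type makes the test channel `W` admissible are covered by a codebook of
exponential size. -/
theorem exists_codebook (d : X → Y → ℝ) (W : X → Y → ℝ) (hW : ∀ x, W x ∈ stdSimplex ℝ Y)
    (q : Y → ℝ) (hq : ∀ y, 0 < q y) (hq1 : ∑ y, q y = 1) [Nonempty X]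
    (D c η : ℝ) (hc : 0 ≤ c) (hη : 0 < η) :
    ∃ n₀ : ℕ, ∀ n, n₀ ≤ n → ∃ B : Finset (Fin n → Y), B.Nonempty ∧
      (B.card : ℝ) ≤ 3 * Real.exp (n * (c + 2 * η)) ∧
      ∀ x : Fin n → X, ∑ i, empirical x i * ∑ y, W i y * d i y ≤ D →
        ∑ i, empirical x i * ∑ y, W i y * Real.log (W i y / q y) ≤ c →
        ∃ y ∈ B, blockDist d x y ≤ D + η := by
  classical
  obtain ⟨n₁, h₁⟩ := ball_prob_ge d W hW q hq D c η hη
  -- The exponent exp(nη)/2 gained by covering must beat n ln |X|, the logarithm of the number of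
  -- blocks.
  have hlim : Filter.Tendsto (fun n : ℕ => Real.exp (n * η) / n) Filter.atTop Filter.atTop := by
    refine ((tendsto_exp_mul_div_rpow_atTop 1 η hη).comp tendsto_natCast_atTop_atTop).congr
      fun n => ?_
    simp [mul_comm]
  obtain ⟨n₂, h₂⟩ := Filter.eventually_atTop.1
    (hlim.eventually_gt_atTop (2 * Real.log (Fintype.card X)))
  refine ⟨max (max n₁ n₂) 1, fun n hn => ?_⟩
  have hn1 : n₁ ≤ n := by omega
  have hn2 : n₂ ≤ n := by omega
  have hpos : 0 < n := by omega
  have hn' : (0 : ℝ) < n := by exact_mod_cast hpos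
  set S : Finset (Fin n → X) := Finset.univ.filter fun x =>
    ∑ i, empirical x i * ∑ y, W i y * d i y ≤ D ∧
      ∑ i, empirical x i * ∑ y, W i y * Real.log (W i y / q y) ≤ c with hS
  set θ := Real.exp (-(n * (c + η))) / 2 with hθ
  have hqn : (fun y : Fin n → Y => ∏ k, q (y k)) ∈ stdSimplex ℝ (Fin n → Y) :=
    ⟨fun y => Finset.prod_nonneg fun k _ => (hq _).le,
      sum_prod_simplex (w := fun _ => q) fun _ => ⟨fun y => (hq y).le, hq1⟩⟩
  have hθ1 : θ ≤ 1 := by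
    have : Real.exp (-(n * (c + η))) ≤ 1 := Real.exp_le_one_iff.2 (by
      have : 0 ≤ n * (c + η) := by positivity
      linarith)
    linarith
  -- With N = ⌈exp(n(c + 2η))⌉ points, Nθ ≥ exp(nη)/2, so the uncovered set has fewer than one
  -- element and is empty. The extra word `y₀` only makes the codebook nonempty; the ceiling and
  -- this word account for the constant 3.
  obtain ⟨T, U, hT, hTU, -, hcov⟩ := exists_cover S (fun x y => blockDist d x y ≤ D + η) _ hqn θ hθ1
    (fun x hx => h₁ n hn1 hpos x (Finset.mem_filter.1 hx).2.1 (Finset.mem_filter.1 hx).2.2)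
    ⌈Real.exp (n * (c + 2 * η))⌉₊
  obtain ⟨y₀⟩ : Nonempty (Fin n → Y) := by
    obtain ⟨x⟩ := ‹Nonempty X›
    obtain ⟨y, -, -⟩ := Finset.exists_ne_zero_of_sum_ne_zero
      (by rw [(hW x).2]; exact one_ne_zero)
    exact ⟨fun _ => y⟩
  have hNle : (⌈Real.exp (n * (c + 2 * η))⌉₊ : ℝ) ≤ 2 * Real.exp (n * (c + 2 * η)) := by
    have h1 : 1 ≤ Real.exp (n * (c + 2 * η)) := Real.one_le_exp (by positivity)
    have := Nat.ceil_lt_add_one (Real.exp_pos (n * (c + 2 * η))).le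
    linarith
  refine ⟨insert y₀ T, Finset.insert_nonempty _ _, ?_, fun x hx1 hx2 => ?_⟩
  · have h1 : 1 ≤ Real.exp (n * (c + 2 * η)) := Real.one_le_exp (by positivity)
    have h2 : ((insert y₀ T).card : ℝ) ≤ T.card + 1 := by
      exact_mod_cast Finset.card_insert_le _ _
    have h3 : (T.card : ℝ) ≤ ⌈Real.exp (n * (c + 2 * η))⌉₊ := by exact_mod_cast hT
    linarith
  by_contra! hcon
  have hmem : x ∈ U := by
    refine (hTU x (Finset.mem_filter.2 ⟨Finset.mem_univ _, hx1, hx2⟩)).resolve_left ?_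
    rintro ⟨y, hy, hxy⟩
    exact absurd hxy (not_le.2 (hcon y (Finset.mem_insert_of_mem hy)))
  have hone : (1 : ℝ) ≤ U.card := by
    exact_mod_cast Finset.card_pos.2 ⟨x, hmem⟩
  have hXpos : (0 : ℝ) < Fintype.card X := by exact_mod_cast Fintype.card_pos
  have hSc : (S.card : ℝ) ≤ Real.exp (n * Real.log (Fintype.card X)) := by
    rw [Real.exp_nat_mul, Real.exp_log hXpos]
    have : S.card ≤ Fintype.card X ^ n := by
      simpa using Finset.card_le_univ S
    exact_mod_cast this
  have hpow : (1 - θ) ^ ⌈Real.exp (n * (c + 2 * η))⌉₊ ≤ Real.exp (-(Real.exp (n * η) / 2)) := by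
    calc (1 - θ) ^ ⌈Real.exp (n * (c + 2 * η))⌉₊
        ≤ (Real.exp (-θ)) ^ ⌈Real.exp (n * (c + 2 * η))⌉₊ :=
          pow_le_pow_left₀ (by linarith) (Real.one_sub_le_exp_neg θ) _
      _ = Real.exp (⌈Real.exp (n * (c + 2 * η))⌉₊ * -θ) := (Real.exp_nat_mul _ _).symm
      _ ≤ _ := by
          refine Real.exp_le_exp.2 ?_
          have h3 := mul_le_mul_of_nonneg_right (Nat.le_ceil (Real.exp (n * (c + 2 * η))))
            (by positivity : 0 ≤ θ)
          have h4 : Real.exp (n * (c + 2 * η)) * θ = Real.exp (n * η) / 2 := by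
            rw [hθ, mul_div_assoc', ← Real.exp_add]
            congr 2
            ring
          linarith
  have hlt := h₂ n hn2
  rw [lt_div_iff₀ hn'] at hlt
  have hfin : (S.card : ℝ) * (1 - θ) ^ ⌈Real.exp (n * (c + 2 * η))⌉₊ < 1 := by
    calc _ ≤ Real.exp (n * Real.log (Fintype.card X)) * Real.exp (-(Real.exp (n * η) / 2)) :=
          mul_le_mul hSc hpow (pow_nonneg (by linarith) _) (Real.exp_pos _).le
      _ < 1 := by
          rw [← Real.exp_add, Real.exp_lt_one_iff]
          linarith
  linarith

end Empirical

/-! ### Mutual information and the rate-distortion function of one law -/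

section Information

variable {X Y : Type*} [Fintype X] [Fintype Y]

/-- This is H(Y) − H(Y|X). Since `Real.negMulLog` is continuous at 0 too, this form shows continuity
in p and in W. -/
theorem mutualInfo_eq {p : X → ℝ} (hp : ∀ x, 0 ≤ p x) {W : X → Y → ℝ} (hW : ∀ x y, 0 ≤ W x y) :
    mutualInfo p W = ∑ y, Real.negMulLog (∑ x, p x * W x y)
      - ∑ x, ∑ y, p x * Real.negMulLog (W x y) := by
  have e : ∑ y, Real.negMulLog (∑ x, p x * W x y) =
      ∑ x, ∑ y, -(p x * W x y * Real.log (∑ x', p x' * W x' y)) := by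
    rw [Finset.sum_comm]
    refine Finset.sum_congr rfl fun y _ => ?_
    rw [Finset.sum_neg_distrib, ← Finset.sum_mul, Real.negMulLog, neg_mul]
  rw [e, ← Finset.sum_sub_distrib, mutualInfo]
  refine Finset.sum_congr rfl fun x _ => ?_
  rw [← Finset.sum_sub_distrib]
  refine Finset.sum_congr rfl fun y _ => ?_
  rw [Real.negMulLog]
  rcases eq_or_ne (p x * W x y) 0 with h0 | h0
  · rw [h0]
    linear_combination -Real.log (W x y) * h0
  · have hq : 0 < ∑ x', p x' * W x' y :=
      Finset.sum_pos' (fun x' _ => mul_nonneg (hp x') (hW x' y))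
        ⟨x, Finset.mem_univ x, lt_of_le_of_ne (mul_nonneg (hp x) (hW x y)) h0.symm⟩
    rw [Real.log_div (right_ne_zero_of_mul h0) hq.ne']
    ring

theorem sum_output_eq_one {p : X → ℝ} (hp : p ∈ stdSimplex ℝ X) {W : X → Y → ℝ}
    (hW : ∀ x, W x ∈ stdSimplex ℝ Y) : ∑ y, ∑ x, p x * W x y = 1 := by
  rw [Finset.sum_comm]
  simp_rw [← Finset.mul_sum, (hW _).2, mul_one]
  exact hp.2

/-- The bound log t ≥ 1 − 1/t holds termwise, and the resulting lower bounds sum to zero. -/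
theorem mutualInfo_nonneg {p : X → ℝ} (hp : p ∈ stdSimplex ℝ X) {W : X → Y → ℝ}
    (hW : ∀ x, W x ∈ stdSimplex ℝ Y) : 0 ≤ mutualInfo p W := by
  have hterm : ∀ x y, p x * W x y - p x * ∑ x', p x' * W x' y ≤
      p x * W x y * Real.log (W x y / ∑ x', p x' * W x' y) := by
    intro x y
    have hq0 : 0 ≤ ∑ x', p x' * W x' y :=
      Finset.sum_nonneg fun x' _ => mul_nonneg (hp.1 x') ((hW x').1 y)
    rcases eq_or_ne (p x * W x y) 0 with h0 | h0
    · rw [h0, zero_mul, zero_sub]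
      exact neg_nonpos.2 (mul_nonneg (hp.1 x) hq0)
    · have hpos : 0 < p x * W x y :=
        lt_of_le_of_ne (mul_nonneg (hp.1 x) ((hW x).1 y)) h0.symm
      have hq : 0 < ∑ x', p x' * W x' y :=
        Finset.sum_pos' (fun x' _ => mul_nonneg (hp.1 x') ((hW x').1 y))
          ⟨x, Finset.mem_univ x, hpos⟩
      have hWp : 0 < W x y :=
        lt_of_le_of_ne ((hW x).1 y) (right_ne_zero_of_mul h0).symm
      have hl := Real.one_sub_inv_le_log_of_pos (div_pos hWp hq)
      calc p x * W x y - p x * ∑ x', p x' * W x' y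
          = p x * W x y * (1 - (W x y / ∑ x', p x' * W x' y)⁻¹) := by field_simp
        _ ≤ _ := mul_le_mul_of_nonneg_left hl hpos.le
  have hsum : ∑ x, ∑ y, (p x * W x y - p x * ∑ x', p x' * W x' y) = 0 := by
    simp_rw [Finset.sum_sub_distrib, ← Finset.mul_sum, (hW _).2, sum_output_eq_one hp hW, sub_self]
  rw [← hsum]
  exact Finset.sum_le_sum fun x _ => Finset.sum_le_sum fun y _ => hterm x y

theorem rateDistortion_le {d : X → Y → ℝ} {p : X → ℝ} (hp : p ∈ stdSimplex ℝ X) {D : ℝ}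
    {W : X → Y → ℝ} (hW : W ∈ admissible d p D) : rateDistortion d p D ≤ mutualInfo p W :=
  csInf_le ⟨0, by rintro _ ⟨V, hV, rfl⟩; exact mutualInfo_nonneg hp hV.1⟩ ⟨W, hW, rfl⟩

theorem rateDistortion_nonneg {d : X → Y → ℝ} {p : X → ℝ} (hp : p ∈ stdSimplex ℝ X) (D : ℝ) :
    0 ≤ rateDistortion d p D :=
  Real.sInf_nonneg (by rintro _ ⟨V, hV, rfl⟩; exact mutualInfo_nonneg hp hV.1)

/-- Sending each letter to a nearest reproduction letter is optimal for all p at once. -/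
theorem exists_min_channel [Nonempty Y] (d : X → Y → ℝ) :
    ∃ W : X → Y → ℝ, (∀ x, W x ∈ stdSimplex ℝ Y) ∧
      ∀ p : X → ℝ, ∑ x, ∑ y, p x * W x y * d x y = dmin d p := by
  classical
  have h : ∀ x, ∃ y, d x y = Finset.univ.inf' Finset.univ_nonempty fun y => d x y := fun x => by
    obtain ⟨y, -, hy⟩ := Finset.exists_mem_eq_inf' Finset.univ_nonempty fun y => d x y
    exact ⟨y, hy.symm⟩
  choose f hf using h
  refine ⟨fun x => Pi.single (f x) 1, fun x => single_mem_stdSimplex ℝ (f x), fun p => ?_⟩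
  refine Finset.sum_congr rfl fun x _ => ?_
  rw [← hf, Finset.sum_eq_single (f x)]
  · simp
  · intro y _ hy
    simp [hy]
  · simp

/-- A test channel with strictly smaller distortion and almost optimal mutual information. -/
theorem exists_strict_channel [Nonempty Y] {d : X → Y → ℝ} {p : X → ℝ} (hp : p ∈ stdSimplex ℝ X)
    {D c : ℝ} (hD : dmin d p < D) (hc : rateDistortion d p D < c) :
    ∃ W : X → Y → ℝ, (∀ x, W x ∈ stdSimplex ℝ Y) ∧ ∑ x, ∑ y, p x * W x y * d x y < D ∧
      mutualInfo p W < c := by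
  obtain ⟨V, hV, hVd⟩ := exists_min_channel d
  have hne : (mutualInfo p '' admissible d p D).Nonempty := ⟨_, V, ⟨hV, by rw [hVd]; exact hD.le⟩, rfl⟩
  obtain ⟨_, ⟨W, hW, rfl⟩, hWc⟩ := exists_lt_of_csInf_lt hne hc
  -- Any weight t > 0 on the nearest-letter channel brings the distortion strictly below D; for
  -- small t, continuity keeps the mutual information below c.
  let U : ℝ → X → Y → ℝ := fun t x y => (1 - t) * W x y + t * V x y
  have hU : ∀ t, 0 ≤ t → t ≤ 1 → ∀ x, U t x ∈ stdSimplex ℝ Y := fun t h0 h1 x =>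
    convex_stdSimplex ℝ Y (hW.1 x) (hV x) (by linarith) h0 (by ring)
  let F : ℝ → ℝ := fun t => ∑ y, Real.negMulLog (∑ x, p x * U t x y)
      - ∑ x, ∑ y, p x * Real.negMulLog (U t x y)
  have hF : Continuous F := by
    have hn := Real.continuous_negMulLog
    fun_prop
  have hF0 : F 0 < c := by
    have : U 0 = W := by ext x y; simp [U]
    simp only [F, this]
    rw [← mutualInfo_eq hp.1 fun x => (hW.1 x).1]
    exact hWc
  have hev : ∀ᶠ t in nhdsWithin (0 : ℝ) (Set.Ioi 0), F t < c :=
    nhdsWithin_le_nhds (hF.continuousAt.eventually_lt_const hF0)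
  obtain ⟨t, ht, ht0, ht1⟩ := (hev.and (Ioo_mem_nhdsGT one_pos)).exists
  refine ⟨U t, hU t ht0.le ht1.le, ?_, ?_⟩
  · have e : ∑ x, ∑ y, p x * U t x y * d x y =
        (1 - t) * ∑ x, ∑ y, p x * W x y * d x y + t * ∑ x, ∑ y, p x * V x y * d x y := by
      simp_rw [Finset.mul_sum, ← Finset.sum_add_distrib]
      refine Finset.sum_congr rfl fun x _ => Finset.sum_congr rfl fun y _ => ?_
      simp only [U]
      ring
    rw [e, hVd]
    nlinarith [hW.2]
  · rw [mutualInfo_eq hp.1 fun x => (hU t ht0.le ht1.le x).1]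
    exact ht

/-- A channel with strict slack at p stays admissible, with mutual information below c, at all
nearby laws. -/
theorem upperSemicontinuousOn_rateDistortion [Nonempty Y] {d : X → Y → ℝ} {D : ℝ}
    {Q : Set (X → ℝ)} (hQ : Q ⊆ stdSimplex ℝ X) (hD : ∀ p ∈ Q, dmin d p < D) :
    UpperSemicontinuousOn (fun p => rateDistortion d p D) Q := by
  intro p hp c hc
  obtain ⟨W, hW, hWD, hWc⟩ := exists_strict_channel (hQ hp) (hD p hp) hc
  let F : (X → ℝ) → ℝ := fun p => ∑ y, Real.negMulLog (∑ x, p x * W x y)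
      - ∑ x, ∑ y, p x * Real.negMulLog (W x y)
  have hF : Continuous F := by
    have hn := Real.continuous_negMulLog
    fun_prop
  have hG : Continuous fun p : X → ℝ => ∑ x, ∑ y, p x * W x y * d x y := by fun_prop
  have hFp : F p < c := by
    rwa [mutualInfo_eq (hQ hp).1 fun x => (hW x).1] at hWc
  filter_upwards [nhdsWithin_le_nhds (hF.continuousAt.eventually_lt_const hFp),
    nhdsWithin_le_nhds (hG.continuousAt.eventually_lt_const hWD), self_mem_nhdsWithin]
    with p' h1 h2 h3
  refine (rateDistortion_le (hQ h3) ⟨hW, h2.le⟩).trans_lt ?_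
  rwa [mutualInfo_eq (hQ h3).1 fun x => (hW x).1]

/-- A positive output law can replace the true one at an arbitrarily small cost. -/
theorem exists_pos_output [Nonempty Y] {p : X → ℝ} (hp : p ∈ stdSimplex ℝ X) {W : X → Y → ℝ}
    (hW : ∀ x, W x ∈ stdSimplex ℝ Y) {c : ℝ} (hc : mutualInfo p W < c) :
    ∃ q : Y → ℝ, (∀ y, 0 < q y) ∧ ∑ y, q y = 1 ∧
      ∑ x, p x * ∑ y, W x y * Real.log (W x y / q y) < c := by
  have hlim : ContinuousAt (fun t : ℝ => mutualInfo p W - Real.log (1 - t)) 0 := by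
    refine ContinuousAt.sub continuousAt_const (ContinuousAt.log ?_ (by norm_num))
    fun_prop
  have hev : ∀ᶠ t in nhdsWithin (0 : ℝ) (Set.Ioi 0), mutualInfo p W - Real.log (1 - t) < c :=
    nhdsWithin_le_nhds (hlim.eventually_lt_const (by simpa using hc))
  obtain ⟨t, ht, ht0, ht1⟩ := (hev.and (Ioo_mem_nhdsGT one_pos)).exists
  have hY : (0 : ℝ) < Fintype.card Y := by exact_mod_cast Fintype.card_pos
  have ht1' : 0 < 1 - t := by linarith
  have hq0 : ∀ y, 0 ≤ ∑ x, p x * W x y := fun y =>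
    Finset.sum_nonneg fun x _ => mul_nonneg (hp.1 x) ((hW x).1 y)
  -- Mixing in the uniform law with weight t makes the output law positive and costs at most −log(1
  -- − t).
  refine ⟨fun y => (1 - t) * ∑ x, p x * W x y + t / Fintype.card Y, fun y => ?_, ?_, ?_⟩
  · have := hq0 y
    positivity
  · rw [Finset.sum_add_distrib, ← Finset.mul_sum, sum_output_eq_one hp hW]
    simp
    field_simp
    ring
  refine lt_of_le_of_lt ?_ ht
  have e : mutualInfo p W - Real.log (1 - t) = ∑ x, ∑ y, (p x * W x y *
      Real.log (W x y / ∑ x', p x' * W x' y) - p x * W x y * Real.log (1 - t)) := by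
    simp_rw [Finset.sum_sub_distrib, ← Finset.sum_mul, ← Finset.mul_sum, (hW _).2, mul_one, hp.2,
      one_mul]
    rfl
  rw [e]
  refine Finset.sum_le_sum fun x _ => ?_
  rw [Finset.mul_sum]
  refine Finset.sum_le_sum fun y _ => ?_
  rw [← mul_assoc, ← mul_sub]
  rcases eq_or_ne (p x * W x y) 0 with h0 | h0
  · simp [h0]
  refine mul_le_mul_of_nonneg_left ?_ (mul_nonneg (hp.1 x) ((hW x).1 y))
  have hpos : 0 < p x * W x y :=
    lt_of_le_of_ne (mul_nonneg (hp.1 x) ((hW x).1 y)) h0.symm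
  have hq : 0 < ∑ x', p x' * W x' y :=
    Finset.sum_pos' (fun x' _ => mul_nonneg (hp.1 x') ((hW x').1 y))
      ⟨x, Finset.mem_univ x, hpos⟩
  have hWp : 0 < W x y := lt_of_le_of_ne ((hW x).1 y) (right_ne_zero_of_mul h0).symm
  rw [← Real.log_div (by positivity) ht1'.ne', div_div, mul_comm _ (1 - t)]
  refine Real.log_le_log (by positivity) ?_
  refine div_le_div_of_nonneg_left hWp.le (by positivity) ?_
  have : 0 ≤ t / Fintype.card Y := by positivity
  linarith

end Information

/-! ### Stochastic dominance -/

section Dominance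

theorem intervalIntegral_step {s v T : ℝ} (hs : s < v) (hT : v ≤ T) :
    ∫ t in s..T, (if v ≤ t then (1 : ℝ) else 0) = T - v := by
  have e : (fun t : ℝ => if v ≤ t then (1 : ℝ) else 0) = (Set.Ici v).indicator fun _ => 1 := by
    ext t
    simp [Set.indicator_apply]
  rw [intervalIntegral.integral_of_le (hs.le.trans hT), e,
    MeasureTheory.setIntegral_indicator measurableSet_Ici]
  have : Set.Ioc s T ∩ Set.Ici v = Set.Icc v T := by
    ext t
    simp only [Set.mem_inter_iff, Set.mem_Ioc, Set.mem_Ici, Set.mem_Icc]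
    constructor
    · rintro ⟨⟨-, h⟩, h'⟩
      exact ⟨h', h⟩
    · rintro ⟨h, h'⟩
      exact ⟨⟨hs.trans_le h, h'⟩, h⟩
  rw [this]
  simp [hT]

theorem intervalIntegrable_cdf {A : Type*} [Fintype A] (p c : A → ℝ) (s T : ℝ) :
    ∀ a ∈ (Finset.univ : Finset A), IntervalIntegrable
      (fun t => p a * (if c a ≤ t then (1 : ℝ) else 0)) MeasureTheory.volume s T := by
  intro a _
  refine IntervalIntegrable.const_mul (Monotone.intervalIntegrable fun t t' h => ?_) _
  split_ifs with h1 h2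
  · exact le_rfl
  · exact absurd (h1.trans h) h2
  · exact zero_le_one
  · exact le_rfl

theorem intervalIntegral_cdf {A : Type*} [Fintype A] (p c : A → ℝ) {s T : ℝ}
    (hs : ∀ a, s < c a) (hT : ∀ a, c a ≤ T) :
    ∫ t in s..T, ∑ a, p a * (if c a ≤ t then (1 : ℝ) else 0) = ∑ a, p a * (T - c a) := by
  rw [intervalIntegral.integral_finsetSum (intervalIntegrable_cdf p c s T)]
  refine Finset.sum_congr rfl fun a _ => ?_
  rw [intervalIntegral.integral_const_mul, intervalIntegral_step (hs a) (hT a)]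

/-- First-order stochastic dominance implies the inequality of the means. -/
theorem mean_le_of_cdf_le {A B : Type*} [Fintype A] [Fintype B] (p c : A → ℝ) (P e : B → ℝ)
    (htot : ∑ a, p a = ∑ b, P b)
    (h : ∀ t, ∑ b, P b * (if e b ≤ t then (1 : ℝ) else 0)
      ≤ ∑ a, p a * (if c a ≤ t then (1 : ℝ) else 0)) :
    ∑ a, p a * c a ≤ ∑ b, P b * e b := by
  obtain ⟨T₁, hT₁⟩ := (Set.finite_range c).bddAbove
  obtain ⟨T₂, hT₂⟩ := (Set.finite_range e).bddAbove
  obtain ⟨s₁, hs₁⟩ := (Set.finite_range c).bddBelow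
  obtain ⟨s₂, hs₂⟩ := (Set.finite_range e).bddBelow
  set T := max T₁ T₂
  -- The −1 puts `s` strictly below all values, as `intervalIntegral_step` requires.
  set s := min T (min s₁ s₂) - 1
  have hsT : s ≤ T := by linarith [min_le_left T (min s₁ s₂)]
  have hss : min T (min s₁ s₂) ≤ s₁ := (min_le_right _ _).trans (min_le_left _ _)
  have hss' : min T (min s₁ s₂) ≤ s₂ := (min_le_right _ _).trans (min_le_right _ _)
  have hcT : ∀ a, c a ≤ T := fun a => (hT₁ ⟨a, rfl⟩).trans (le_max_left _ _)
  have heT : ∀ b, e b ≤ T := fun b => (hT₂ ⟨b, rfl⟩).trans (le_max_right _ _)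
  have hcs : ∀ a, s < c a := fun a => by have := hs₁ ⟨a, rfl⟩; linarith
  have hes : ∀ b, s < e b := fun b => by have := hs₂ ⟨b, rfl⟩; linarith
  -- The integral of a distribution function over [s, T] is the mean of T minus the variable, so a
  -- pointwise inequality of distribution functions reverses into one of means.
  have key := intervalIntegral.integral_mono hsT
    (IntervalIntegrable.sum _ (intervalIntegrable_cdf P e s T))
    (IntervalIntegrable.sum _ (intervalIntegrable_cdf p c s T))
    (fun t => by simpa only [Finset.sum_apply] using h t)
  simp only [Finset.sum_apply] at key
  rw [intervalIntegral_cdf P e hes heT, intervalIntegral_cdf p c hcs hcT] at key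
  simp_rw [mul_sub, Finset.sum_sub_distrib, ← Finset.sum_mul] at key
  rw [htot] at key
  linarith

end Dominance

/-! ### The simulable distributions and their equality with C -/

section Supported

variable {X : Type*} [Fintype X]

/-- Probability mass functions on `X` that are supported in `V`. -/
def pmfOn (V : Finset X) : Set (X → ℝ) := {g | g ∈ stdSimplex ℝ X ∧ ∀ x, x ∉ V → g x = 0}

theorem isCompact_pmfOn (V : Finset X) : IsCompact (pmfOn V) := by
  have e : pmfOn V = stdSimplex ℝ X ∩ ⋂ x, ⋂ (_ : x ∉ V), {g : X → ℝ | g x = 0} := by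
    ext g
    simp [pmfOn]
  rw [e]
  refine (isCompact_stdSimplex ℝ X).inter_right (isClosed_iInter fun x => isClosed_iInter fun _ => ?_)
  exact isClosed_eq (continuous_apply x) continuous_const

theorem convex_pmfOn (V : Finset X) : Convex ℝ (pmfOn V) := by
  intro g hg h hh a b ha hb hab
  refine ⟨convex_stdSimplex ℝ X hg.1 hh.1 ha hb hab, fun x hx => ?_⟩
  simp [hg.2 x hx, hh.2 x hx]

end Supported

section Simulation

variable {X : Type*} [Fintype X] [DecidableEq X] {m : ℕ}

/-- Tuples are grouped by their set of values, which is always nonempty with at most `m` elements,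
so the restriction on V loses nothing. -/
theorem sum_beta_mul (hm : 1 ≤ m) (P : (Fin m → X) → ℝ) (G : Finset X → ℝ) :
    ∑ V with V.Nonempty ∧ V.card ≤ m, beta P V * G V = ∑ a, P a * G (Finset.univ.image a) := by
  have : Nonempty (Fin m) := ⟨⟨0, hm⟩⟩
  simp_rw [beta, Finset.sum_mul, Finset.sum_filter (s := (Finset.univ : Finset (Fin m → X)))]
  rw [Finset.sum_comm]
  refine Finset.sum_congr rfl fun a _ => ?_
  rw [Finset.sum_ite_eq, if_pos]
  refine Finset.mem_filter.2 ⟨Finset.mem_univ _, Finset.univ_nonempty.image a, ?_⟩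
  exact Finset.card_image_le.trans (by simp)

/-- When all subsource outputs lie in V, the rule puts its whole mass on V. -/
theorem setSim_subset_setC (hm : 1 ≤ m) {P : (Fin m → X) → ℝ} (hP : ∀ a, 0 ≤ P a) :
    setSim P ⊆ setC P := by
  rintro p ⟨hp, f, hf, hpf⟩
  have : Nonempty (Fin m) := ⟨⟨0, hm⟩⟩
  have hfa : ∀ a : Fin m → X, f (Finset.univ.image a) ∈ stdSimplex ℝ X ∧
      ∀ x, x ∉ Finset.univ.image a → f (Finset.univ.image a) x = 0 := fun a =>
    hf _ (Finset.univ_nonempty.image a) (Finset.card_image_le.trans (by simp))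
  refine ⟨hp, fun V => ?_⟩
  simp_rw [hpf, sum_beta_mul hm P fun V => f V _]
  rw [Finset.sum_comm, probAllIn, Finset.sum_filter]
  refine Finset.sum_le_sum fun a _ => ?_
  rw [← Finset.mul_sum]
  split_ifs with h
  · have : ∑ i ∈ V, f (Finset.univ.image a) i = 1 := by
      rw [← (hfa a).1.2]
      refine Finset.sum_subset (Finset.subset_univ _) fun x _ hx => (hfa a).2 x fun hx' => hx ?_
      obtain ⟨l, -, rfl⟩ := Finset.mem_image.1 hx'
      exact h l
    rw [this, mul_one]
  · exact mul_nonneg (hP a) (Finset.sum_nonneg fun i _ => (hfa a).1.1 i)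

/-- The output law of a memoryless rule, as a linear function of the rule. -/
def simMap (P : (Fin m → X) → ℝ) : (Finset X → X → ℝ) →ₗ[ℝ] (X → ℝ) where
  toFun f x := ∑ a, P a * f (Finset.univ.image a) x
  map_add' g h := by
    ext x
    simp [mul_add, Finset.sum_add_distrib]
  map_smul' c g := by
    ext x
    simp [Finset.mul_sum, mul_left_comm]

theorem mem_setSim_of_forall (hm : 1 ≤ m) {P : (Fin m → X) → ℝ}
    (hP : P ∈ stdSimplex ℝ (Fin m → X)) {f : Finset X → X → ℝ}
    (hf : ∀ V : Finset X, V.Nonempty → f V ∈ pmfOn V) :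
    (fun x => ∑ a, P a * f (Finset.univ.image a) x) ∈ setSim P := by
  have : Nonempty (Fin m) := ⟨⟨0, hm⟩⟩
  have hfa : ∀ a : Fin m → X, f (Finset.univ.image a) ∈ stdSimplex ℝ X := fun a =>
    (hf _ (Finset.univ_nonempty.image a)).1
  refine ⟨⟨fun x => Finset.sum_nonneg fun a _ => mul_nonneg (hP.1 a) ((hfa a).1 x), ?_⟩,
    f, fun V hV _ => hf V hV, fun x => (sum_beta_mul hm P fun V => f V x).symm⟩
  rw [Finset.sum_comm]
  simp_rw [← Finset.mul_sum, (hfa _).2, mul_one]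
  exact hP.2

theorem pmfOn_nonempty {V : Finset X} (hV : V.Nonempty) : (pmfOn V).Nonempty := by
  obtain ⟨x, hx⟩ := hV
  refine ⟨Pi.single x 1, single_mem_stdSimplex ℝ x, fun y hy => ?_⟩
  have : y ≠ x := by rintro rfl; exact hy hx
  simp [this]

theorem setSim_nonempty (hm : 1 ≤ m) {P : (Fin m → X) → ℝ}
    (hP : P ∈ stdSimplex ℝ (Fin m → X)) : (setSim P).Nonempty := by
  classical
  exact ⟨_, mem_setSim_of_forall hm hP (f := fun V => if h : V.Nonempty then
    (pmfOn_nonempty h).some else 0) fun V hV => by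
      simp only [hV, dif_pos]
      exact (pmfOn_nonempty hV).some_mem⟩

/-- The channels that draw a letter of `V` when the set of subsource outputs is `V`. -/
def simChannels (X : Type*) [Fintype X] [DecidableEq X] : Set (Finset X → X → ℝ) :=
  Set.pi Set.univ fun V => if V.Nonempty then pmfOn V else {0}

/-- The values of `f` that `setSim` leaves free never matter and are filled in so that the channels
form a compact convex product; its linear image is then closed and convex. -/
theorem setSim_eq_image (hm : 1 ≤ m) {P : (Fin m → X) → ℝ}
    (hP : P ∈ stdSimplex ℝ (Fin m → X)) :
    setSim P = simMap P '' simChannels X := by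
  classical
  have : Nonempty (Fin m) := ⟨⟨0, hm⟩⟩
  ext p
  constructor
  · rintro ⟨hp, f, hf, hpf⟩
    refine ⟨fun V => if V.Nonempty ∧ V.card ≤ m then f V else
      if h : V.Nonempty then (pmfOn_nonempty h).some else 0, ?_, ?_⟩
    · intro V _
      by_cases hV : V.Nonempty
      · by_cases hVm : V.card ≤ m
        · have hfV : f V ∈ pmfOn V := hf V hV hVm
          simpa [hV, hVm] using hfV
        · simpa [hV, hVm] using (pmfOn_nonempty hV).some_mem
      · simp [hV]
    · ext x
      rw [hpf, sum_beta_mul hm P fun V => f V x]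
      simp only [simMap, LinearMap.coe_mk, AddHom.coe_mk]
      refine Finset.sum_congr rfl fun a _ => ?_
      rw [if_pos ⟨Finset.univ_nonempty.image a, Finset.card_image_le.trans (by simp)⟩]
  · rintro ⟨f, hf, rfl⟩
    refine mem_setSim_of_forall hm hP fun V hV => ?_
    have := hf V (Set.mem_univ V)
    simpa [hV] using this

theorem isClosed_setSim (hm : 1 ≤ m) {P : (Fin m → X) → ℝ}
    (hP : P ∈ stdSimplex ℝ (Fin m → X)) : IsClosed (setSim P) := by
  rw [setSim_eq_image hm hP]
  refine (IsCompact.image ?_ (LinearMap.continuous_of_finiteDimensional _)).isClosed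
  refine isCompact_univ_pi fun V => ?_
  split_ifs
  · exact isCompact_pmfOn V
  · exact isCompact_singleton

theorem convex_setSim (hm : 1 ≤ m) {P : (Fin m → X) → ℝ}
    (hP : P ∈ stdSimplex ℝ (Fin m → X)) : Convex ℝ (setSim P) := by
  rw [setSim_eq_image hm hP]
  refine Convex.linear_image (convex_pi fun V _ => ?_) _
  split_ifs
  · exact convex_pmfOn V
  · exact convex_singleton 0

theorem setC_eq_setSim (hm : 1 ≤ m) {P : (Fin m → X) → ℝ}
    (hP : P ∈ stdSimplex ℝ (Fin m → X)) : setC P = setSim P := by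
  refine Set.Subset.antisymm (fun p hp => ?_) (setSim_subset_setC hm hP.1)
  by_contra hnot
  -- A functional with weights `c` would give `p` a mean above those of all simulable laws, while
  -- picking a `c`-maximal available letter already does at least as well as `p`.
  obtain ⟨φ, u, hlt, hup⟩ :=
    geometric_hahn_banach_closed_point (convex_setSim hm hP) (isClosed_setSim hm hP) hnot
  set c : X → ℝ := fun x => φ (Pi.single x 1) with hc
  have hφ : ∀ g : X → ℝ, φ g = ∑ x, g x * c x := by
    intro g
    conv_lhs => rw [pi_eq_sum_univ' g]
    rw [map_sum]
    refine Finset.sum_congr rfl fun x _ => ?_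
    rw [map_smul, smul_eq_mul]
  have hmax : ∀ V : Finset X, V.Nonempty → ∃ x ∈ V, ∀ y ∈ V, c y ≤ c x := fun V hV =>
    Finset.exists_max_image V c hV
  have : Nonempty X := by
    by_contra hX
    rw [not_nonempty_iff] at hX
    simpa using hp.1.2
  choose! b hbV hbmax using hmax
  have : Nonempty (Fin m) := ⟨⟨0, hm⟩⟩
  have hb := hlt _ (mem_setSim_of_forall hm hP (f := fun V => Pi.single (b V) 1) fun V hV => by
    refine ⟨single_mem_stdSimplex ℝ _, fun x hx => ?_⟩
    have : x ≠ b V := by rintro rfl; exact hx (hbV V hV)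
    simp [this])
  rw [hφ] at hup hb
  have e : ∑ x, (∑ a, P a * (Pi.single (b (Finset.univ.image a)) 1 : X → ℝ) x) * c x =
      ∑ a, P a * c (b (Finset.univ.image a)) := by
    simp_rw [Finset.sum_mul]
    rw [Finset.sum_comm]
    refine Finset.sum_congr rfl fun a _ => ?_
    simp [Pi.single_apply]
  rw [e] at hb
  refine absurd (mean_le_of_cdf_le p c P (fun a => c (b (Finset.univ.image a)))
    (hp.1.2.trans hP.2.symm) fun t => ?_) (not_le.2 (hb.trans hup))
  -- The chosen letter has `c` at most t only if all available letters do; the constraint of `setC`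
  -- for this sublevel set is thus exactly the dominance needed.
  have h := hp.2 (Finset.univ.filter fun x => c x ≤ t)
  rw [probAllIn, Finset.sum_filter, Finset.sum_filter] at h
  simp_rw [mul_ite, mul_one, mul_zero]
  refine le_trans (Finset.sum_le_sum fun a _ => ?_) h
  split_ifs with h1 h2 h2
  · exact le_rfl
  · refine absurd (fun l => ?_) h2
    refine Finset.mem_filter.2 ⟨Finset.mem_univ _, le_trans ?_ h1⟩
    exact hbmax _ (Finset.univ_nonempty.image a) _ (Finset.mem_image_of_mem _ (Finset.mem_univ l))
  · exact hP.1 a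
  · exact le_rfl

theorem isCompact_setC (P : (Fin m → X) → ℝ) : IsCompact (setC P) := by
  have e : setC P = stdSimplex ℝ X ∩ ⋂ V : Finset X, {p | probAllIn P V ≤ ∑ i ∈ V, p i} := by
    ext p
    simp [setC]
  rw [e]
  refine (isCompact_stdSimplex ℝ X).inter_right (isClosed_iInter fun V => ?_)
  exact isClosed_le continuous_const (by fun_prop)

theorem sum_jointLaw_current {n : ℕ} (P : (Fin m → X) → ℝ) (q : Fin n → (Fin m → X) → Fin m → ℝ)
    (x : Fin n → X) :
    ∑ s, jointLaw P (fun ω s => ∏ k, q k (ω k) (s k)) s x =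
      ∏ k, ∑ a, P a * ∑ l, q k a l * if x k = a l then 1 else 0 := by
  rw [← sum_prod_eq_prod_sum fun k a => P a * ∑ l, q k a l * if x k = a l then 1 else 0]
  simp_rw [jointLaw]
  rw [Finset.sum_comm]
  refine Finset.sum_congr rfl fun ω _ => ?_
  rw [← Finset.mul_sum, Finset.prod_mul_distrib,
    ← sum_prod_eq_prod_sum fun k l => q k (ω k) l * if x k = ω k l then 1 else 0]
  simp_rw [Finset.prod_mul_distrib]

/-- Every distribution in `setSim` is simulated by a memoryless randomized rule. -/
theorem exists_current_rule (hm : 1 ≤ m) {P : (Fin m → X) → ℝ} {p : X → ℝ} (hp : p ∈ setSim P)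
    (n : ℕ) : ∃ Q ∈ currentRules X m n, ∀ x, ∑ s, jointLaw P Q s x = ∏ k, p (x k) := by
  obtain ⟨-, f, hf, hpf⟩ := hp
  have : Nonempty (Fin m) := ⟨⟨0, hm⟩⟩
  have hfa : ∀ a : Fin m → X, f (Finset.univ.image a) ∈ stdSimplex ℝ X ∧
      ∀ x, x ∉ Finset.univ.image a → f (Finset.univ.image a) x = 0 := fun a =>
    hf _ (Finset.univ_nonempty.image a) (Finset.card_image_le.trans (by simp))
  -- Several subsources may show the same letter; the mass that `f` gives to it is split equally
  -- among them.
  let N : (Fin m → X) → X → ℝ := fun a x => (Finset.univ.filter fun l => a l = x).card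
  have hN : ∀ a, ∀ x ∈ Finset.univ.image a, N a x ≠ 0 := by
    intro a x hx
    obtain ⟨l, -, hl⟩ := Finset.mem_image.1 hx
    have : (Finset.univ.filter fun l => a l = x).card ≠ 0 :=
      Finset.card_ne_zero_of_mem (Finset.mem_filter.2 ⟨Finset.mem_univ l, hl⟩)
    exact Nat.cast_ne_zero.2 this
  have hsum : ∀ (a : Fin m → X) (g : X → ℝ),
      ∑ l, f (Finset.univ.image a) (a l) / N a (a l) * g (a l) =
        ∑ x, f (Finset.univ.image a) x * g x := by
    intro a g
    rw [Finset.sum_comp (fun x => f (Finset.univ.image a) x / N a x * g x) a]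
    rw [← Finset.sum_subset (Finset.subset_univ (Finset.univ.image a))
      fun x _ hx => by rw [(hfa a).2 x hx, zero_mul]]
    refine Finset.sum_congr rfl fun x hx => ?_
    have := hN a x hx
    rw [nsmul_eq_mul]
    change N a x * _ = _
    field_simp
  refine ⟨fun ω s => ∏ k, f (Finset.univ.image (ω k)) (ω k (s k)) / N (ω k) (ω k (s k)),
    ⟨fun _ a l => f (Finset.univ.image a) (a l) / N a (a l), fun _ a => ⟨fun l => ?_, ?_⟩,
      fun _ _ => rfl⟩, fun x => ?_⟩
  · exact div_nonneg ((hfa a).1.1 _) (Nat.cast_nonneg _)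
  · have := hsum a fun _ => 1
    simp only [mul_one] at this
    rw [this, (hfa a).1.2]
  · rw [sum_jointLaw_current P (fun _ a l => f (Finset.univ.image a) (a l) / N a (a l))]
    refine Finset.prod_congr rfl fun k _ => ?_
    rw [hpf, sum_beta_mul hm P fun V => f V (x k)]
    refine Finset.sum_congr rfl fun a _ => ?_
    rw [hsum a fun y => if x k = y then 1 else 0]
    simp

end Simulation

/-! ### Inclusions between the classes of rules -/

section Rules

variable {X : Type*} {m : ℕ}

theorem currentRules_subset_fullRules (n : ℕ) : currentRules X m n ⊆ fullRules X m n := by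
  rintro Q ⟨q, hq, hQ⟩ ω
  refine ⟨fun s => ?_, ?_⟩
  · rw [hQ]
    exact Finset.prod_nonneg fun k _ => (hq k _).1 _
  · simp_rw [hQ]
    exact sum_prod_simplex fun k => hq k (ω k)

theorem currentRules_subset_oneStepRules (n : ℕ) : currentRules X m n ⊆ oneStepRules X m n := by
  intro Q hQ'
  refine ⟨currentRules_subset_fullRules n hQ', fun k ω ω' hω t => ?_⟩
  obtain ⟨q, hq, hQ⟩ := hQ'
  -- Summing out the positions after time `k` contributes factors 1, which leaves only factors that
  -- depend on the outputs up to time `k`.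
  have e : ∀ ω : Fin n → Fin m → X,
      ∑ s : Fin n → Fin m with ∀ j ≤ k, s j = t j, Q ω s =
        ∏ i, if i ≤ k then q i (ω i) (t i) else 1 := by
    intro ω
    have e1 : ∀ s : Fin n → Fin m, (if ∀ j ≤ k, s j = t j then Q ω s else 0) =
        ∏ i, q i (ω i) (s i) * if i ≤ k → s i = t i then 1 else 0 := by
      intro s
      rw [Finset.prod_mul_distrib, hQ, Finset.prod_ite_zero]
      simp
    rw [Finset.sum_filter, Finset.sum_congr rfl fun s _ => e1 s,
      sum_prod_eq_prod_sum fun i l => q i (ω i) l * if i ≤ k → l = t i then 1 else 0]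
    refine Finset.prod_congr rfl fun i _ => ?_
    by_cases hi : i ≤ k
    · simp [hi]
    · simp [hi, (hq i (ω i)).2]
  rw [e, e]
  refine Finset.prod_congr rfl fun i _ => ?_
  split_ifs with hi
  · rw [hω i hi]
  · rfl

theorem currentRules_subset_rules (a : Lookahead) (n : ℕ) : currentRules X m n ⊆ rules X m a n := by
  cases a
  · exact subset_rfl
  · exact currentRules_subset_oneStepRules n
  · exact currentRules_subset_fullRules n

theorem rules_subset_fullRules (a : Lookahead) (n : ℕ) : rules X m a n ⊆ fullRules X m n := by
  cases a
  · exact currentRules_subset_fullRules n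
  · exact fun Q hQ => hQ.1
  · exact subset_rfl

end Rules

/-! ### Converse for IID sources -/

section Converse

variable {X Y : Type*} [Fintype X] [Fintype Y] {n : ℕ}

/-- Converse of the rate-distortion theorem for an IID source. -/
theorem mul_rateDistortion_le_log_card [Nonempty Y] {d : X → Y → ℝ} {p : X → ℝ}
    (hp : p ∈ stdSimplex ℝ X) (hn : 0 < n) (B : Finset (Fin n → Y)) (hB : B.Nonempty) {D : ℝ}
    (hD : ∑ x : Fin n → X, (∏ k, p (x k)) * codeDist d B hB x ≤ D) :
    n * rateDistortion d p D ≤ Real.log B.card := by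
  classical
  have hn' : (0 : ℝ) < n := by exact_mod_cast hn
  have hex : ∀ x : Fin n → X, ∃ y ∈ B, codeDist d B hB x = blockDist d x y := fun x =>
    Finset.exists_mem_eq_inf' hB _
  choose f hfB hf using hex
  set w : (Fin n → X) → ℝ := fun z => ∏ k, p (z k) with hw
  have hw0 : ∀ z, 0 ≤ w z := fun z => Finset.prod_nonneg fun k _ => hp.1 _
  have hw1 : ∑ z, w z = 1 := sum_prod_simplex (w := fun _ => p) fun _ => hp
  -- The joint law of a source letter and its codeword letter at a uniformly random time.
  let J : X → Y → ℝ := fun x y =>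
    (∑ z, w z * ∑ k, if z k = x ∧ f z k = y then (1 : ℝ) else 0) / n
  have hJ0 : ∀ x y, 0 ≤ J x y := fun x y => div_nonneg (Finset.sum_nonneg fun z _ =>
    mul_nonneg (hw0 z) (Finset.sum_nonneg fun k _ => by split_ifs <;> norm_num)) hn'.le
  have hJsum : ∀ h : X → Y → ℝ, ∑ x, ∑ y, J x y * h x y =
      (∑ z, w z * ∑ k, h (z k) (f z k)) / n := by
    intro h
    have e1 : ∀ z : Fin n → X, ∀ k, h (z k) (f z k) =
        ∑ x, ∑ y, (if z k = x ∧ f z k = y then (1 : ℝ) else 0) * h x y := by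
      intro z k
      rw [Finset.sum_eq_single (z k), Finset.sum_eq_single (f z k)]
      · simp
      · intro y _ hy
        simp [hy.symm]
      · simp
      · intro x _ hx
        simp [hx.symm]
      · simp
    simp_rw [e1, J, div_mul_eq_mul_div, ← Finset.sum_div]
    congr 1
    have e2 : ∀ x y, (∑ z, w z * ∑ k, if z k = x ∧ f z k = y then (1 : ℝ) else 0) * h x y =
        ∑ z, w z * ∑ k, (if z k = x ∧ f z k = y then (1 : ℝ) else 0) * h x y := by
      intro x y
      simp_rw [Finset.sum_mul, mul_assoc, Finset.sum_mul]
    simp_rw [e2]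
    rw [Finset.sum_congr rfl fun x _ => Finset.sum_comm, Finset.sum_comm]
    refine Finset.sum_congr rfl fun z _ => ?_
    simp_rw [← Finset.mul_sum]
    congr 1
    rw [Finset.sum_congr rfl fun x _ => Finset.sum_comm, Finset.sum_comm]
  have hJmarg : ∀ x, ∑ y, J x y = p x := by
    intro x
    have h1 := hJsum fun x' _ => if x' = x then 1 else 0
    have h2 : ∑ x', ∑ y, J x' y * (if x' = x then (1 : ℝ) else 0) = ∑ y, J x y := by
      simp
    rw [← h2, h1]
    simp_rw [Finset.mul_sum]
    rw [Finset.sum_comm]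
    have h3 : ∀ k : Fin n, ∑ z : Fin n → X, w z * (if z k = x then (1 : ℝ) else 0) = p x := by
      intro k
      rw [hw, sum_prod_mul_apply (w := fun _ => p) (fun _ => hp) k fun b => if b = x then 1 else 0]
      simp
    simp_rw [h3]
    simp [hn'.ne']
  obtain ⟨y₀⟩ := ‹Nonempty Y›
  -- The conditional law of `J`; letters of probability zero get an arbitrary point mass so that `W`
  -- is a transition matrix.
  let W : X → Y → ℝ := fun x => if p x = 0 then Pi.single y₀ 1 else fun y => J x y / p x
  have hW : ∀ x, W x ∈ stdSimplex ℝ Y := by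
    intro x
    by_cases hx : p x = 0
    · simp only [W, hx, if_true]
      exact single_mem_stdSimplex ℝ y₀
    · simp only [W, hx, if_false]
      refine ⟨fun y => div_nonneg (hJ0 x y) (hp.1 x), ?_⟩
      rw [← Finset.sum_div, hJmarg, div_self hx]
  have hpW : ∀ x y, p x * W x y = J x y := by
    intro x y
    by_cases hx : p x = 0
    · have h0 : ∑ y, J x y = 0 := by rw [hJmarg, hx]
      rw [hx, zero_mul, (Finset.sum_eq_zero_iff_of_nonneg fun y _ => hJ0 x y).1 h0 y
        (Finset.mem_univ y)]
    · simp only [W, hx, if_false]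
      field_simp
  have hadm : W ∈ admissible d p D := by
    refine ⟨hW, ?_⟩
    simp_rw [hpW]
    rw [hJsum d, Finset.sum_div]
    refine le_trans (le_of_eq (Finset.sum_congr rfl fun z _ => ?_)) hD
    rw [hf, blockDist]
    ring
  set q : Y → ℝ := fun y => ∑ x', p x' * W x' y with hq
  let r : X → Y → ℝ := fun x y => W x y / q y
  have hq0 : ∀ y, 0 ≤ q y := fun y =>
    Finset.sum_nonneg fun x _ => mul_nonneg (hp.1 x) ((hW x).1 y)
  have hr0 : ∀ x y, 0 ≤ r x y := fun x y => div_nonneg ((hW x).1 y) (hq0 y)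
  have hI : n * mutualInfo p W = ∑ z, w z * ∑ k, Real.log (r (z k) (f z k)) := by
    have : mutualInfo p W = ∑ x, ∑ y, J x y * Real.log (r x y) := by
      simp_rw [← hpW]
      rfl
    rw [this, hJsum fun x y => Real.log (r x y)]
    field_simp
  have hrpos : ∀ z, w z ≠ 0 → ∀ k, 0 < r (z k) (f z k) := by
    intro z hz k
    have hz' : 0 < w z := lt_of_le_of_ne (hw0 z) hz.symm
    have hJpos : 0 < J (z k) (f z k) := by
      refine div_pos (Finset.sum_pos' (fun z' _ => mul_nonneg (hw0 z')
        (Finset.sum_nonneg fun k _ => by split_ifs <;> norm_num)) ⟨z, Finset.mem_univ z, ?_⟩) hn'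
      refine mul_pos hz' (Finset.sum_pos' (fun k _ => by split_ifs <;> norm_num)
        ⟨k, Finset.mem_univ k, by simp⟩)
    rw [← hpW] at hJpos
    have hWpos : 0 < W (z k) (f z k) :=
      lt_of_le_of_ne ((hW _).1 _) (right_ne_zero_of_mul hJpos.ne').symm
    exact div_pos hWpos (Finset.sum_pos' (fun x _ => mul_nonneg (hp.1 x) ((hW x).1 _))
      ⟨z k, Finset.mem_univ _, hJpos⟩)
  have hBpos : (0 : ℝ) < B.card := by exact_mod_cast hB.card_pos
  -- This is log t ≤ t − 1 for t the likelihood ratio of the chosen codeword divided by |B|, with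
  -- that ratio bounded by the sum over all codewords. No convexity of R(p, ·) enters.
  have hterm : ∀ z, w z * ∑ k, Real.log (r (z k) (f z k)) ≤
      w z * Real.log B.card + ((∑ y ∈ B, w z * ∏ k, r (z k) (y k)) / B.card - w z) := by
    intro z
    by_cases hz : w z = 0
    · simp [hz]
    have hprod : 0 < ∏ k, r (z k) (f z k) := Finset.prod_pos fun k _ => hrpos z hz k
    have h1 : ∑ k, Real.log (r (z k) (f z k)) = Real.log (∏ k, r (z k) (f z k)) :=
      (Real.log_prod fun k _ => (hrpos z hz k).ne').symm
    have h2 := Real.log_le_sub_one_of_pos (div_pos hprod hBpos)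
    rw [Real.log_div hprod.ne' hBpos.ne'] at h2
    have h3 : ∏ k, r (z k) (f z k) ≤ ∑ y ∈ B, ∏ k, r (z k) (y k) :=
      Finset.single_le_sum (f := fun y : Fin n → Y => ∏ k, r (z k) (y k))
        (fun y _ => Finset.prod_nonneg fun k _ => hr0 _ _) (hfB z)
    have h4 : (∏ k, r (z k) (f z k)) / B.card ≤ (∑ y ∈ B, ∏ k, r (z k) (y k)) / B.card :=
      div_le_div_of_nonneg_right h3 hBpos.le
    rw [h1, ← Finset.mul_sum, mul_div_assoc]
    have h5 := mul_le_mul_of_nonneg_left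
      (show Real.log (∏ k, r (z k) (f z k)) ≤
        Real.log B.card + ((∑ y ∈ B, ∏ k, r (z k) (y k)) / B.card - 1) by linarith) (hw0 z)
    linarith
  have hmass : ∑ z, ∑ y ∈ B, w z * ∏ k, r (z k) (y k) ≤ B.card := by
    rw [Finset.sum_comm]
    -- For a fixed codeword the mean factors over time into terms q(y_k)/q(y_k), each 1, or 0 when
    -- q(y_k) = 0.
    have : ∀ y ∈ B, ∑ z : Fin n → X, w z * ∏ k, r (z k) (y k) ≤ 1 := by
      intro y _
      simp_rw [hw, ← Finset.prod_mul_distrib]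
      rw [sum_prod_eq_prod_sum fun k x => p x * r x (y k)]
      refine Finset.prod_le_one (fun k _ => Finset.sum_nonneg fun x _ =>
        mul_nonneg (hp.1 x) (hr0 x _)) fun k _ => ?_
      simp_rw [r, mul_div_assoc', ← Finset.sum_div]
      exact div_self_le_one _
    calc _ ≤ ∑ y ∈ B, (1 : ℝ) := Finset.sum_le_sum this
      _ = B.card := by simp
  calc n * rateDistortion d p D ≤ n * mutualInfo p W :=
        mul_le_mul_of_nonneg_left (rateDistortion_le hp hadm) hn'.le
    _ ≤ ∑ z, (w z * Real.log B.card +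
          ((∑ y ∈ B, w z * ∏ k, r (z k) (y k)) / B.card - w z)) := by
        rw [hI]
        exact Finset.sum_le_sum fun z _ => hterm z
    _ = Real.log B.card + ((∑ z, ∑ y ∈ B, w z * ∏ k, r (z k) (y k)) / B.card - 1) := by
        rw [Finset.sum_add_distrib, Finset.sum_sub_distrib, ← Finset.sum_mul, hw1, one_mul,
          Finset.sum_div]
    _ ≤ Real.log B.card := by
        have := (div_le_one hBpos).2 hmass
        linarith

theorem dmin_le_sum_codeDist [Nonempty Y] (d : X → Y → ℝ) {p : X → ℝ}
    (hp : p ∈ stdSimplex ℝ X) (hn : 0 < n) (B : Finset (Fin n → Y)) (hB : B.Nonempty) :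
    dmin d p ≤ ∑ x : Fin n → X, (∏ k, p (x k)) * codeDist d B hB x := by
  have hn' : (0 : ℝ) < n := by exact_mod_cast hn
  set g : X → ℝ := fun x => Finset.univ.inf' Finset.univ_nonempty fun y => d x y with hg
  have h1 : ∀ x : Fin n → X, (∑ k, g (x k)) / n ≤ codeDist d B hB x := by
    intro x
    refine Finset.le_inf' _ _ fun y _ => ?_
    rw [blockDist, div_eq_inv_mul, one_div]
    refine mul_le_mul_of_nonneg_left (Finset.sum_le_sum fun k _ => ?_) (by positivity)
    exact Finset.inf'_le _ (Finset.mem_univ _)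
  have h2 : ∑ x : Fin n → X, (∏ k, p (x k)) * ((∑ k, g (x k)) / n) = dmin d p := by
    simp_rw [mul_div_assoc', ← Finset.sum_div, Finset.mul_sum]
    rw [Finset.sum_comm]
    simp_rw [sum_prod_mul_apply (w := fun _ => p) (fun _ => hp)]
    simp only [Finset.sum_const, Finset.card_univ, Fintype.card_fin, nsmul_eq_mul, dmin, hg]
    field_simp
  rw [← h2]
  exact Finset.sum_le_sum fun x _ =>
    mul_le_mul_of_nonneg_left (h1 x) (Finset.prod_nonneg fun k _ => hp.1 _)

end Converse

/-! ### Direct part against full lookahead -/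

section Bound

variable {X Y : Type*} [Fintype X] [Fintype Y]

theorem exists_codeDist_le [Nonempty X] [Nonempty Y] (d : X → Y → ℝ) :
    ∃ M, 0 ≤ M ∧ ∀ (n : ℕ) (B : Finset (Fin n → Y)) (hB : B.Nonempty) (x : Fin n → X),
      codeDist d B hB x ≤ M := by
  obtain ⟨M, hM⟩ := exists_abs_le d
  have hM0 : 0 ≤ M := (abs_nonneg _).trans (hM (Classical.arbitrary X) (Classical.arbitrary Y))
  refine ⟨M, hM0, fun n B hB x => ?_⟩
  obtain ⟨y, hy⟩ := hB
  refine (Finset.inf'_le _ hy).trans ?_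
  rw [blockDist, one_div]
  rcases n.eq_zero_or_pos with rfl | hn
  · simpa using hM0
  have hn' : (0 : ℝ) < n := by exact_mod_cast hn
  rw [inv_mul_le_iff₀ hn']
  calc ∑ k, d (x k) (y k) ≤ ∑ _k : Fin n, M :=
        Finset.sum_le_sum fun k _ => (le_abs_self _).trans (hM _ _)
    _ = n * M := by simp

end Bound

section Achievability

variable {X Y : Type*} [Fintype X] [DecidableEq X] {m : ℕ}

/-- The output is determined by `ω` and `s`; in this form the distortion can be bounded uniformly
over the switch positions for each `ω`. -/
theorem expDist_eq {n : ℕ} (d : X → Y → ℝ) (P : (Fin m → X) → ℝ) (Q : Rule X m n)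
    (B : Finset (Fin n → Y)) (hB : B.Nonempty) :
    expDist d P Q B hB = ∑ ω : Fin n → Fin m → X, (∏ k, P (ω k)) *
      ∑ s, Q ω s * codeDist d B hB fun k => ω k (s k) := by
  simp_rw [expDist, jointLaw, Finset.sum_mul]
  rw [Finset.sum_congr rfl fun x _ => Finset.sum_comm, Finset.sum_comm]
  refine Finset.sum_congr rfl fun ω _ => ?_
  rw [Finset.sum_comm, Finset.mul_sum]
  refine Finset.sum_congr rfl fun s _ => ?_
  rw [Finset.sum_eq_single fun k => ω k (s k)]
  · simp [mul_assoc]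
  · intro x _ hx
    obtain ⟨k, hk⟩ := Function.ne_iff.1 hx
    rw [Finset.prod_eq_zero (f := fun k => if x k = ω k (s k) then (1 : ℝ) else 0)
      (Finset.mem_univ k) (if_neg hk)]
    simp
  · simp

/-- Codebooks that cover all blocks whose type is close to `setC P`. -/
theorem exists_codebook_near_setC [Nonempty X] [Fintype Y] [Nonempty Y] {d : X → Y → ℝ}
    {P : (Fin m → X) → ℝ} {D r c : ℝ} (hC : ∀ p ∈ setC P, dmin d p < D)
    (hr : ∀ p ∈ setC P, rateDistortion d p D ≤ r) (hrc : r < c) (hc : 0 ≤ c) :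
    ∃ D₁ < D, ∃ δ > 0, ∃ K : ℝ, ∃ n₀ : ℕ, ∀ n, n₀ ≤ n →
      ∃ (B : Finset (Fin n → Y)) (hB : B.Nonempty), (B.card : ℝ) ≤ K * Real.exp (n * c) ∧
        ∀ x : Fin n → X, empirical x ∈ stdSimplex ℝ X →
          (∀ V : Finset X, probAllIn P V - δ ≤ ∑ i ∈ V, empirical x i) →
          codeDist d B hB x ≤ D₁ := by
  classical
  have hone : ∀ n : ℕ, (1 : ℝ) ≤ 1 * Real.exp (n * c) := fun n => by
    rw [one_mul]
    exact Real.one_le_exp (by positivity)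
  -- The property of a set of types is that one codebook per block length serves all its types that
  -- nearly satisfy the constraints of C. It passes to unions by uniting codebooks: the constants
  -- `K` add, `D₁` becomes a maximum and `δ` a minimum.
  refine IsCompact.induction_on (isCompact_stdSimplex ℝ X) ?_ ?_ ?_ ?_
  · refine ⟨D - 1, by linarith, 1, one_pos, 1, 0, fun n _ =>
      ⟨{fun _ => Classical.arbitrary Y}, Finset.singleton_nonempty _, ?_, fun x hx => hx.elim⟩⟩
    simpa using hone n
  · intro s t hst ht
    obtain ⟨D₁, hD₁, δ, hδ, K, n₀, h⟩ := ht
    refine ⟨D₁, hD₁, δ, hδ, K, n₀, fun n hn => ?_⟩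
    obtain ⟨B, hB, hcard, hcov⟩ := h n hn
    exact ⟨B, hB, hcard, fun x hx => hcov x (hst hx)⟩
  · intro s t hs ht
    obtain ⟨D₁, hD₁, δ, hδ, K, n₀, h⟩ := hs
    obtain ⟨D₁', hD₁', δ', hδ', K', n₀', h'⟩ := ht
    refine ⟨max D₁ D₁', max_lt hD₁ hD₁', min δ δ', lt_min hδ hδ', K + K', max n₀ n₀',
      fun n hn => ?_⟩
    obtain ⟨B, hB, hcard, hcov⟩ := h n ((le_max_left _ _).trans hn)
    obtain ⟨B', hB', hcard', hcov'⟩ := h' n ((le_max_right _ _).trans hn)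
    refine ⟨B ∪ B', hB.mono Finset.subset_union_left, ?_, fun x hx hV => ?_⟩
    · have : ((B ∪ B').card : ℝ) ≤ B.card + B'.card := by
        exact_mod_cast Finset.card_union_le B B'
      linarith
    · rcases hx with hx | hx
      · refine le_trans (Finset.inf'_mono _ Finset.subset_union_left hB)
          (le_trans (hcov x hx fun V => ?_) (le_max_left _ _))
        linarith [hV V, min_le_left δ δ']
      · refine le_trans (Finset.inf'_mono _ Finset.subset_union_right hB')
          (le_trans (hcov' x hx fun V => ?_) (le_max_right _ _))
        linarith [hV V, min_le_right δ δ']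
  · intro p hp
    by_cases hpC : p ∈ setC P
    · obtain ⟨c', hrc', hcc'⟩ := exists_between hrc
      obtain ⟨W, hW, hWD, hWI⟩ := exists_strict_channel hp (hC p hpC) ((hr p hpC).trans_lt hrc')
      obtain ⟨q, hq, hq1, hqc⟩ := exists_pos_output hp hW hWI
      obtain ⟨D', hD', hDD'⟩ := exists_between hWD
      have hc' : 0 ≤ c' := (mutualInfo_nonneg hp hW).trans hWI.le
      -- Half of each gap, so that `D' + η < D` and `c' + 2 * η ≤ c`.
      set η := min ((D - D') / 2) ((c - c') / 2) with hη
      have hη0 : 0 < η := lt_min (by linarith) (by linarith)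
      have hη1 : η ≤ (D - D') / 2 := min_le_left _ _
      have hη2 : η ≤ (c - c') / 2 := min_le_right _ _
      obtain ⟨n₀, h⟩ := exists_codebook d W hW q hq hq1 D' c' η hc' hη0
      -- With `W` and `q` fixed, both conditions are linear in the type and hence open.
      refine ⟨{p | ∑ x, p x * ∑ y, W x y * d x y < D' ∧
        ∑ x, p x * ∑ y, W x y * Real.log (W x y / q y) < c'}, ?_, D' + η, by linarith, 1, one_pos,
        3, n₀, fun n hn => ?_⟩
      · have h1 : Continuous fun p : X → ℝ => ∑ x, p x * ∑ y, W x y * d x y := by fun_prop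
        have h2 : Continuous fun p : X → ℝ => ∑ x, p x * ∑ y, W x y * Real.log (W x y / q y) := by
          fun_prop
        have h3 : ∑ x, p x * ∑ y, W x y * d x y < D' := by
          simpa only [Finset.mul_sum, ← mul_assoc] using hD'
        exact nhdsWithin_le_nhds ((h1.continuousAt.eventually_lt_const h3).and
          (h2.continuousAt.eventually_lt_const hqc))
      · obtain ⟨B, hB, hcard, hcov⟩ := h n hn
        refine ⟨B, hB, hcard.trans ?_, fun x hx _ => ?_⟩
        · refine mul_le_mul_of_nonneg_left (Real.exp_le_exp.2 ?_) (by norm_num)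
          exact mul_le_mul_of_nonneg_left (by linarith) (Nat.cast_nonneg _)
        · obtain ⟨y, hy, hxy⟩ := hcov x hx.1.le hx.2.le
          exact (Finset.inf'_le _ hy).trans hxy
    -- Near a law outside C one constraint fails by more than a fixed `δ`, so there is nothing to
    -- cover and a one-word codebook suffices.
    · have hV : ∃ V : Finset X, ∑ i ∈ V, p i < probAllIn P V := by
        by_contra! hcon
        exact hpC ⟨hp, hcon⟩
      obtain ⟨V, hV⟩ := hV
      obtain ⟨v, hv, hv'⟩ := exists_between hV
      refine ⟨{p | ∑ i ∈ V, p i < v}, mem_nhdsWithin_of_mem_nhds (IsOpen.mem_nhds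
        (isOpen_lt (by fun_prop) continuous_const) hv), D - 1, by linarith, probAllIn P V - v,
        by linarith, 1, 0, fun n _ => ⟨{fun _ => Classical.arbitrary Y},
          Finset.singleton_nonempty _, by simpa using hone n, fun x hx hx' => ?_⟩⟩
      have h1 := hx' V
      have h2 : ∑ i ∈ V, empirical x i < v := hx
      linarith

/-- Whatever the switcher does, the type of the output is close to `setC P` with high
probability. -/
theorem expDist_le {n : ℕ} (hn : 0 < n) {d : X → Y → ℝ} {P : (Fin m → X) → ℝ}
    (hP : P ∈ stdSimplex ℝ (Fin m → X)) {Q : Rule X m n} (hQ : Q ∈ fullRules X m n)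
    {B : Finset (Fin n → Y)} {hB : B.Nonempty} {D₁ M δ : ℝ} (hδ : 0 < δ) (hM0 : 0 ≤ M)
    (hM : ∀ x, codeDist d B hB x ≤ D₁ + M)
    (hcov : ∀ x : Fin n → X, (∀ V : Finset X, probAllIn P V - δ ≤ ∑ i ∈ V, empirical x i) →
      codeDist d B hB x ≤ D₁) :
    expDist d P Q B hB ≤ D₁ + M * (Fintype.card (Finset X) * (4 / δ ^ 2)) / n := by
  classical
  have hn' : (0 : ℝ) < n := by exact_mod_cast hn
  -- The sign turns the upper tail of `tail_le` into a lower tail for the frequency of the event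
  -- that all subsources lie in V.
  let h : Finset X → (Fin m → X) → ℝ := fun V a => if ∀ l, a l ∈ V then -1 else 0
  let bad : Finset X → (Fin n → Fin m → X) → Prop := fun V ω =>
    n * δ < ∑ k, h V (ω k) - ∑ _k : Fin n, ∑ a, P a * h V a
  have hbad : ∀ V, ∑ ω with bad V ω, ∏ k, P (ω k) ≤ 4 / δ ^ 2 / n := by
    intro V
    have := tail_le (w := fun _ : Fin n => P) (fun _ => hP) (fun _ => h V) 1
      (fun k a => by simp only [h]; split_ifs <;> simp) hn hδ
    simpa [bad] using this
  have hmean : ∀ V, ∑ a, P a * h V a = - probAllIn P V := by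
    intro V
    rw [probAllIn, Finset.sum_filter, ← Finset.sum_neg_distrib]
    refine Finset.sum_congr rfl fun a _ => ?_
    simp only [h]
    split_ifs <;> simp
  have hgood : ∀ (ω : Fin n → Fin m → X) (s : Fin n → Fin m), (∀ V, ¬ bad V ω) →
      codeDist d B hB (fun k => ω k (s k)) ≤ D₁ := by
    intro ω s hω
    refine hcov _ fun V => ?_
    have h1 := hω V
    simp only [bad, not_lt, hmean, Finset.sum_const, Finset.card_univ, Fintype.card_fin,
      nsmul_eq_mul] at h1
    rw [sum_empirical, le_div_iff₀ hn']
    -- The only restriction on the switcher: when all subsources are in V, so is the output, for any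
    -- `s`.
    have h2 : -∑ k, h V (ω k) ≤ ∑ k, if ω k (s k) ∈ V then (1 : ℝ) else 0 := by
      rw [← Finset.sum_neg_distrib]
      refine Finset.sum_le_sum fun k _ => ?_
      simp only [h]
      split_ifs with h3 h4 h4
      · simp
      · exact absurd (h3 _) h4
      · simp
      · simp
    linarith
  have hP0 : ∀ ω : Fin n → Fin m → X, 0 ≤ ∏ k, P (ω k) := fun ω =>
    Finset.prod_nonneg fun k _ => hP.1 _
  have hbound : ∀ ω, ∑ s, Q ω s * codeDist d B hB (fun k => ω k (s k)) ≤
      D₁ + M * ∑ V, if bad V ω then (1 : ℝ) else 0 := by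
    intro ω
    have : ∀ s : Fin n → Fin m, codeDist d B hB (fun k => ω k (s k)) ≤
        D₁ + M * ∑ V, if bad V ω then (1 : ℝ) else 0 := by
      intro s
      by_cases hω : ∀ V, ¬ bad V ω
      · simpa [hω] using hgood ω s hω
      · push Not at hω
        obtain ⟨V, hV⟩ := hω
        have h1 : (1 : ℝ) ≤ ∑ V, if bad V ω then (1 : ℝ) else 0 := by
          have := Finset.single_le_sum (f := fun V => if bad V ω then (1 : ℝ) else 0)
            (fun V _ => by split_ifs <;> norm_num) (Finset.mem_univ V)
          simpa [hV] using this
        nlinarith [hM fun k => ω k (s k)]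
    calc _ ≤ ∑ s, Q ω s * (D₁ + M * ∑ V, if bad V ω then (1 : ℝ) else 0) :=
          Finset.sum_le_sum fun s _ => mul_le_mul_of_nonneg_left (this s) ((hQ ω).1 s)
      _ = _ := by rw [← Finset.sum_mul, (hQ ω).2, one_mul]
  rw [expDist_eq]
  calc _ ≤ ∑ ω : Fin n → Fin m → X,
        (∏ k, P (ω k)) * (D₁ + M * ∑ V, if bad V ω then (1 : ℝ) else 0) :=
        Finset.sum_le_sum fun ω _ => mul_le_mul_of_nonneg_left (hbound ω) (hP0 ω)
    _ = D₁ + M * ∑ V, ∑ ω with bad V ω, ∏ k, P (ω k) := by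
        simp_rw [mul_add, Finset.sum_add_distrib, ← Finset.sum_mul,
          sum_prod_simplex (w := fun _ : Fin n => P) fun _ => hP, one_mul]
        congr 1
        simp_rw [Finset.sum_filter, Finset.mul_sum]
        rw [Finset.sum_comm]
        refine Finset.sum_congr rfl fun V _ => Finset.sum_congr rfl fun ω _ => ?_
        split_ifs <;> ring
    _ ≤ D₁ + M * ∑ _V : Finset X, 4 / δ ^ 2 / n := by
        gcongr with V
        exact hbad V
    _ = _ := by
        rw [Finset.sum_const, Finset.card_univ, nsmul_eq_mul]
        ring

/-- Direct part: a codebook of rate slightly above `max R(p, D)` works against every switcher. -/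
theorem eventually_exists_codebook [Nonempty X] [Fintype Y] [Nonempty Y] {d : X → Y → ℝ}
    {P : (Fin m → X) → ℝ} (hP : P ∈ stdSimplex ℝ (Fin m → X)) {D r c : ℝ}
    (hC : ∀ p ∈ setC P, dmin d p < D) (hr : ∀ p ∈ setC P, rateDistortion d p D ≤ r)
    (hr0 : 0 ≤ r) (hrc : r < c) :
    ∀ᶠ n : ℕ in Filter.atTop, ∃ (B : Finset (Fin n → Y)) (hB : B.Nonempty),
      (∀ Q ∈ fullRules X m n, expDist d P Q B hB ≤ D) ∧ (B.card : ℝ) ≤ Real.exp (n * c) := by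
  obtain ⟨c', hrc', hcc'⟩ := exists_between hrc
  obtain ⟨D₁, hD₁, δ, hδ, K, n₀, h⟩ :=
    exists_codebook_near_setC hC hr hrc' (hr0.trans hrc'.le)
  obtain ⟨M, hM0, hM⟩ := exists_codeDist_le d
  -- The O(1/n) contribution of atypical blocks fits into the gap `D - D₁`. Adding `|D₁|` to `M`
  -- makes it bound the excess over `D₁`, whatever the sign of `D₁`.
  have hA : ∀ᶠ n : ℕ in Filter.atTop,
      (M + |D₁|) * (Fintype.card (Finset X) * (4 / δ ^ 2)) / n < D - D₁ :=
    (tendsto_const_div_atTop_nhds_zero_nat _).eventually_lt_const (by linarith)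
  have hK : ∀ᶠ n : ℕ in Filter.atTop, K ≤ Real.exp (n * (c - c')) := by
    have : Filter.Tendsto (fun n : ℕ => Real.exp (n * (c - c'))) Filter.atTop Filter.atTop :=
      Real.tendsto_exp_atTop.comp
        (tendsto_natCast_atTop_atTop.atTop_mul_const (by linarith))
    exact this.eventually_ge_atTop K
  filter_upwards [hA, hK, Filter.eventually_ge_atTop n₀, Filter.eventually_gt_atTop 0]
    with n h1 h2 h3 h4
  obtain ⟨B, hB, hcard, hcov⟩ := h n h3
  refine ⟨B, hB, fun Q hQ => ?_, hcard.trans ?_⟩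
  · have := expDist_le h4 hP hQ hδ (M := M + |D₁|) (D₁ := D₁) (by positivity)
      (fun x => (hM n B hB x).trans (by linarith [neg_abs_le D₁]))
      (fun x => hcov x (empirical_mem x h4))
    linarith
  · calc K * Real.exp (n * c') ≤ Real.exp (n * (c - c')) * Real.exp (n * c') := by gcongr
      _ = Real.exp (n * c) := by
        rw [← Real.exp_add]
        congr 1
        ring

end Achievability

/-! ### From codebooks to block rates -/

section Rate

variable {X Y : Type*} [Fintype X] [DecidableEq X] {m : ℕ}

theorem blockRate_le {d : X → Y → ℝ} {P : (Fin m → X) → ℝ} {a : Lookahead} {D c : ℝ} {n : ℕ}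
    (hn : 0 < n) {B : Finset (Fin n → Y)} {hB : B.Nonempty}
    (h : ∀ Q ∈ rules X m a n, expDist d P Q B hB ≤ D) (hc : (B.card : ℝ) ≤ Real.exp (n * c)) :
    blockRate d P a D n ≤ c := by
  have h1 : minCode d P a n D ≤ B.card := iInf_le_of_le B (iInf_le_of_le hB (iInf_le _ h))
  have h2 : ENat.toENNReal (minCode d P a n D) ≤ ENNReal.ofReal (Real.exp (n * c)) := by
    refine (ENat.toENNReal_mono h1).trans ?_
    rw [ENat.toENNReal_coe, ← ENNReal.ofReal_natCast]
    exact ENNReal.ofReal_le_ofReal hc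
  have h3 := ENNReal.log_le_log h2
  rw [ENNReal.log_ofReal_of_pos (Real.exp_pos _), Real.log_exp] at h3
  rw [blockRate, EReal.div_le_iff_le_mul (by exact_mod_cast hn) (EReal.natCast_ne_top n)]
  refine h3.trans (le_of_eq ?_)
  push_cast
  rfl

theorem le_blockRate {d : X → Y → ℝ} {P : (Fin m → X) → ℝ} {a : Lookahead} {D c : ℝ} {n : ℕ}
    (hn : 0 < n) (h : ∀ (B : Finset (Fin n → Y)) (hB : B.Nonempty),
      (∀ Q ∈ rules X m a n, expDist d P Q B hB ≤ D) → n * c ≤ Real.log B.card) :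
    (c : EReal) ≤ blockRate d P a D n := by
  have h1 : ((⌈Real.exp (n * c)⌉₊ : ℕ) : ℕ∞) ≤ minCode d P a n D := by
    refine le_iInf fun B => le_iInf fun hB => le_iInf fun hQ => ?_
    have hpos : (0 : ℝ) < B.card := by exact_mod_cast hB.card_pos
    have := (Real.le_log_iff_exp_le hpos).1 (h B hB hQ)
    exact_mod_cast Nat.ceil_le.2 this
  have h2 : ENNReal.ofReal (Real.exp (n * c)) ≤ ENat.toENNReal (minCode d P a n D) := by
    refine le_trans ?_ (ENat.toENNReal_mono h1)
    rw [ENat.toENNReal_coe, ← ENNReal.ofReal_natCast]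
    exact ENNReal.ofReal_le_ofReal (Nat.le_ceil _)
  have h3 := ENNReal.log_le_log h2
  rw [ENNReal.log_ofReal_of_pos (Real.exp_pos _), Real.log_exp] at h3
  rw [blockRate, EReal.le_div_iff_mul_le (by exact_mod_cast hn) (EReal.natCast_ne_top n)]
  refine le_trans (le_of_eq ?_) h3
  rw [mul_comm]
  push_cast
  rfl

theorem blockRate_eq_top {d : X → Y → ℝ} {P : (Fin m → X) → ℝ} {a : Lookahead} {D : ℝ} {n : ℕ}
    (hn : 0 < n) (h : ∀ (B : Finset (Fin n → Y)) (hB : B.Nonempty),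
      ¬ ∀ Q ∈ rules X m a n, expDist d P Q B hB ≤ D) :
    blockRate d P a D n = ⊤ := by
  have h1 : minCode d P a n D = ⊤ :=
    iInf_eq_top.2 fun B => iInf_eq_top.2 fun hB => iInf_eq_top.2 fun hQ => absurd hQ (h B hB)
  rw [blockRate, h1, ENat.toENNReal_top, ENNReal.log_top,
    EReal.top_div_of_pos_ne_top (by exact_mod_cast hn) (EReal.natCast_ne_top n)]

/-- A memoryless switcher forces the expected distortion under every IID law in `setC P`. -/
theorem sum_codeDist_le {d : X → Y → ℝ} (hm : 1 ≤ m) {P : (Fin m → X) → ℝ}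
    (hP : P ∈ stdSimplex ℝ (Fin m → X)) {p : X → ℝ} (hp : p ∈ setC P) {a : Lookahead} {n : ℕ}
    {D : ℝ} {B : Finset (Fin n → Y)} {hB : B.Nonempty}
    (h : ∀ Q ∈ rules X m a n, expDist d P Q B hB ≤ D) :
    ∑ x : Fin n → X, (∏ k, p (x k)) * codeDist d B hB x ≤ D := by
  rw [setC_eq_setSim hm hP] at hp
  obtain ⟨Q, hQ, hlaw⟩ := exists_current_rule hm hp n
  have := h Q (currentRules_subset_rules a n hQ)
  simpa only [expDist, hlaw] using this

end Rate

end AVS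

/-! ### The coding theorem -/

theorem theorem1 {X Y : Type*} [Fintype X] [DecidableEq X] [Fintype Y] [Nonempty Y]
    (m : ℕ) (hm : 1 ≤ m) (d : X → Y → ℝ) (hd : ∀ x y, 0 ≤ d x y)
    (P : (Fin m → X) → ℝ) (hP : P ∈ stdSimplex ℝ (Fin m → X)) :
    (∀ (a : AVS.Lookahead) (D : ℝ),
      (AVS.dminSet d (AVS.setC P) < D →
        ∃ r : ℝ, IsGreatest ((fun p => AVS.rateDistortion d p D) '' AVS.setC P) r ∧
          AVS.rate d P a D = (r : EReal) ∧
          Filter.liminf (AVS.blockRate d P a D) Filter.atTop = (r : EReal)) ∧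
      (D < AVS.dminSet d (AVS.setC P) → AVS.rate d P a D = ⊤)) ∧
    AVS.setC P = AVS.setSim P := by
  refine ⟨fun a D => ⟨fun hD => ?_, fun hD => ?_⟩, AVS.setC_eq_setSim hm hP⟩
  · have hne : (AVS.setC P).Nonempty := by
      rw [AVS.setC_eq_setSim hm hP]
      exact AVS.setSim_nonempty hm hP
    have hcont : Continuous (AVS.dmin d) := by
      unfold AVS.dmin
      fun_prop
    -- A real `sSup` is an upper bound only for a bounded set; compactness of C provides this.
    have hC : ∀ p ∈ AVS.setC P, AVS.dmin d p < D := fun p hp =>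
      (le_csSup ((AVS.isCompact_setC P).image hcont).bddAbove ⟨p, hp, rfl⟩).trans_lt hD
    have hsub : AVS.setC P ⊆ stdSimplex ℝ X := fun p hp => hp.1
    obtain ⟨p, hp, hmax⟩ := (AVS.upperSemicontinuousOn_rateDistortion hsub hC).exists_isMaxOn
      hne (AVS.isCompact_setC P)
    have : Nonempty X := by
      by_contra hX
      rw [not_nonempty_iff] at hX
      simpa using hp.1.2
    set r := AVS.rateDistortion d p D with hr
    -- The lower bound holds at every positive block length, so it bounds the liminf as well.
    have hge : ∀ᶠ n : ℕ in Filter.atTop, (r : EReal) ≤ AVS.blockRate d P a D n := by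
      filter_upwards [Filter.eventually_gt_atTop 0] with n hn
      exact AVS.le_blockRate hn fun B hB hQ =>
        AVS.mul_rateDistortion_le_log_card hp.1 hn B hB (AVS.sum_codeDist_le hm hP hp hQ)
    have hle : ∀ c : ℝ, (r : EReal) < c →
        ∀ᶠ n : ℕ in Filter.atTop, AVS.blockRate d P a D n ≤ c := by
      intro c hc
      filter_upwards [AVS.eventually_exists_codebook hP hC (fun p' hp' => hmax hp')
        (AVS.rateDistortion_nonneg hp.1 D) (EReal.coe_lt_coe_iff.1 hc),
        Filter.eventually_gt_atTop 0] with n ⟨B, hB, hQ, hcard⟩ hn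
      exact AVS.blockRate_le hn (fun Q h => hQ Q (AVS.rules_subset_fullRules a n h)) hcard
    have hsup : AVS.rate d P a D ≤ r :=
      EReal.le_of_forall_lt_iff_le.1 fun c hc => Filter.limsup_le_of_le (h := hle c hc)
    have hinf : (r : EReal) ≤ Filter.liminf (AVS.blockRate d P a D) Filter.atTop :=
      Filter.le_liminf_of_le (h := hge)
    have hil : Filter.liminf (AVS.blockRate d P a D) Filter.atTop ≤ AVS.rate d P a D :=
      Filter.liminf_le_limsup
    refine ⟨r, ⟨⟨p, hp, rfl⟩, ?_⟩, le_antisymm hsup (hinf.trans hil),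
      le_antisymm (hil.trans hsup) hinf⟩
    rintro _ ⟨p', hp', rfl⟩
    exact hmax hp'
  · have hne : (AVS.setC P).Nonempty := by
      rw [AVS.setC_eq_setSim hm hP]
      exact AVS.setSim_nonempty hm hP
    obtain ⟨_, ⟨p, hp, rfl⟩, hpD⟩ := exists_lt_of_lt_csSup (hne.image _) hD
    have htop : ∀ᶠ n : ℕ in Filter.atTop, (⊤ : EReal) ≤ AVS.blockRate d P a D n := by
      filter_upwards [Filter.eventually_gt_atTop 0] with n hn
      refine (AVS.blockRate_eq_top hn fun B hB hQ => ?_).ge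
      exact absurd ((AVS.dmin_le_sum_codeDist d hp.1 hn B hB).trans
        (AVS.sum_codeDist_le hm hP hp hQ)) (not_le.2 hpD)
    exact top_le_iff.1 ((Filter.le_liminf_of_le (h := htop)).trans Filter.liminf_le_limsup)
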